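/- Let $n\ge 2$ and $N\ge 0$ be integers, let $t_0=\infty$, let $t_1,\dots,t_n\in\mathbb C$ be pairwise distinct, $P=\{t_0,\dots,t_n\}$, and let $Q=\{q_1,\dots,q_N\}\subset\mathbb C\setminus P$ consist of $N$ distinct points. Put $\psi(z)=\prod_{i=1}^n(z-t_i)\prod_{j=1}^N(z-q_j)$ and consider the equations $$w''+\frac{G(z)}{\psi(z)}\,w'+\frac{H(z)}{\psi(z)^2}\,w=0,\qquad G=\sum_{m=0}^{n+N-1}G_mz^m,\quad H=\sum_{m=0}^{2(n+N-1)}H_mz^m, \tag{1}$$ identified with the points $(G_m,H_m)$ of an affine space. The exponents of $w''+a\,w'+b\,w=0$ at a point $c\in\mathbb C$ are the two roots of $\rho(\rho-1)+g\rho+h=0$, $g=\lim_{z\to c}(z-c)a(z)$, $h=\lim_{z\to c}(z-c)^2b(z)$; the exponents at $\infty$ are those at $u=0$ of the equation written in the coordinate $u=1/z$. A point $c$ is an apparent singularity of weight $1$ if near $c$ there are a holomorphic solution $w_1$ with $w_1(c)\ne0$ and a holomorphic solution $w_2=(z-c)^2h(z)$ with $h$ holomorphic and $h(c)\neq 0$.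 Fix $\rho^i_1,\rho^i_2\in\mathbb C$ ($0\le i\le n$) satisfying Fuchs' relation $\sum_{i=0}^n(\rho^i_1+\rho^i_2)=n-1-N$. Let $V$ be the set of equations (1) that have exponents $\rho^i_1,\rho^i_2$ at $t_i$ for $0\le i\le n$ and apparent singularities of weight $1$ at all points of $Q$. For $p\in\mathbb C^N$ let $V_p$ be the set of equations in $V$ with momenta $\lim_{z\to q_j}(z-q_j)H(z)/\psi(z)^2=p_j$, $1\le j\le N$. Then: 1. $V$ is an algebraic set of dimension $n-2$. 2. Every equation in $V$ has momenta, that is, $V=\bigcup_pV_p$. The coefficients $G_m$ are the same for all equations in $V$, and there are constants $\beta_i$, $\delta_j\ne0$, $\varepsilon_j$, independent of $p$, such that an equation (1) with these $G_m$ lies in $V_p$ if and only if $H$ solves the linear system of $n+3N+1$ equations in $2n+2N-1$ unknowns $$H_{2(n+N-1)}=\rho^0_1\rho^0_2,\quad H(t_i)=\beta_i,\quad H(q_j)=0,\quad H'(q_j)=p_j/\mu_j,\quad H''(q_j)=\delta_jp_j^2+\varepsilon_jp_j$$ ($1\le i\le n$, $1\le j\le N$), where $\mu_j=\prod_{i}(q_j-t_i)^{-2}\prod_{k\ne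 j}(q_j-q_k)^{-2}$. The matrix of this system has maximal rank $\min(n+3N+1,\,2n+2N-1)$. 3. If $N\le n-2$, then for every $p\in\mathbb C^N$ the set $V_p$ is a non-empty affine space of dimension $n-2-N$; in particular the linear system is underdetermined if $N<n-2$. 4. If $N>n-2$, there are $N-n+2$ polynomials $F_{n-1},\dots,F_N\in\mathbb C[p_1,\dots,p_N]$ of degree $2$ such that $V_p\neq\emptyset$ if and only if $F_j(p)=0$ for all $j$, and then $V_p$ is a single point. These constraints are independent: for $j,k\in\{n-1,\dots,N\}$ the monomial $p_j^2$ occurs in $F_k$ if and only if $j=k$; the $F_j$ are algebraically independent over $\mathbb C$; and their common zero set in $\mathbb C^N$ has dimension $n-2$. -/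

import Mathlib

open Filter Topology

namespace Fuchs

noncomputable section

/-! ### Local notions for an equation `w'' + a w' + b w = 0` -/

/-- `ρ₁, ρ₂` (with multiplicity) are the exponents at `c` of `w'' + a w' + b w = 0`: the limits
`g = lim (z - c) a(z)` and `h = lim (z - c)² b(z)` exist and `ρ₁, ρ₂` are the roots of the indicial
equation `ρ (ρ - 1) + g ρ + h = 0`. -/
def HasExponentsAt (a b : ℂ → ℂ) (c ρ₁ ρ₂ : ℂ) : Prop :=
  ∃ g h : ℂ,
    Tendsto (fun z => (z - c) * a z) (𝓝[≠] c) (𝓝 g) ∧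
    Tendsto (fun z => (z - c) ^ 2 * b z) (𝓝[≠] c) (𝓝 h) ∧
    ∀ ρ : ℂ, ρ * (ρ - 1) + g * ρ + h = (ρ - ρ₁) * (ρ - ρ₂)

/-- The exponents at infinity, i.e. at `u = 0` in the coordinate `u = 1 / z`, in which
`w'' + a w' + b w = 0` reads `w_uu + (2 / u - a(1/u) / u²) w_u + (b(1/u) / u⁴) w = 0`. -/
def HasExponentsAtInfty (a b : ℂ → ℂ) (ρ₁ ρ₂ : ℂ) : Prop :=
  HasExponentsAt (fun u => 2 / u - a u⁻¹ / u ^ 2) (fun u => b u⁻¹ / u ^ 4) 0 ρ₁ ρ₂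

/-- `w` is holomorphic near `c` and solves `w'' + a w' + b w = 0` on a punctured
neighbourhood of `c`. -/
def IsRegularSolutionNear (a b : ℂ → ℂ) (c : ℂ) (w : ℂ → ℂ) : Prop :=
  AnalyticAt ℂ w c ∧ ∀ᶠ z in 𝓝[≠] c, deriv (deriv w) z + a z * deriv w z + b z * w z = 0

/-- `c` is an apparent singularity of weight `1`: near `c` there is a fundamental system of
holomorphic solutions `w₁, w₂` with `w₁ c ≠ 0` and `w₂ = (z - c)² h`, `h` holomorphic, `h c ≠ 0`.
(Two such solutions are automatically linearly independent.) -/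
def IsApparentSingularity (a b : ℂ → ℂ) (c : ℂ) : Prop :=
  ∃ w₁ w₂ h : ℂ → ℂ,
    IsRegularSolutionNear a b c w₁ ∧ w₁ c ≠ 0 ∧
    IsRegularSolutionNear a b c w₂ ∧
    AnalyticAt ℂ h c ∧ h c ≠ 0 ∧ ∀ᶠ z in 𝓝 c, w₂ z = (z - c) ^ 2 * h z

/-! ### The family of equations `w'' + (G / ψ) w' + (H / ψ²) w = 0` -/

/-- Indices of the coefficients: those of `G` (degree `≤ n + N - 1`) and those of `H`
(degree `≤ 2 (n + N - 1)`). -/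
abbrev CoeffIndex (n N : ℕ) : Type := Fin (n + N) ⊕ Fin (2 * (n + N) - 1)

/-- The affine space of coefficients `(G_0, …, G_{n+N-1}, H_0, …, H_{2(n+N-1)})`. -/
abbrev CoeffSpace (n N : ℕ) : Type := CoeffIndex n N → ℂ

variable {n N : ℕ}

/-- `ψ(z) = ∏ (z - t_i) ∏ (z - q_j)`. -/
def psi (t : Fin n → ℂ) (q : Fin N → ℂ) (z : ℂ) : ℂ :=
  (∏ i, (z - t i)) * ∏ j, (z - q j)

/-- `G(z) = ∑ G_m z^m`. -/
def evalG (x : CoeffSpace n N) (z : ℂ) : ℂ := ∑ m, x (Sum.inl m) * z ^ (m : ℕ)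

/-- `H(z) = ∑ H_m z^m`. -/
def evalH (x : CoeffSpace n N) (z : ℂ) : ℂ := ∑ m, x (Sum.inr m) * z ^ (m : ℕ)

/-- The coefficient `G / ψ` of `w'`. -/
def coeffA (t : Fin n → ℂ) (q : Fin N → ℂ) (x : CoeffSpace n N) (z : ℂ) : ℂ :=
  evalG x z / psi t q z

/-- The coefficient `H / ψ²` of `w`. -/
def coeffB (t : Fin n → ℂ) (q : Fin N → ℂ) (x : CoeffSpace n N) (z : ℂ) : ℂ :=
  evalH x z / psi t q z ^ 2

/-- The space of equations with exponents `ρ₁ 0, ρ₂ 0` at infinity, `ρ₁ i, ρ₂ i` at `t_i`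
(`1 ≤ i ≤ n`), and apparent singularities of weight `1` at every `q_j`. -/
def equationSpace (t : Fin n → ℂ) (q : Fin N → ℂ) (ρ₁ ρ₂ : Fin (n + 1) → ℂ) :
    Set (CoeffSpace n N) :=
  {x | HasExponentsAtInfty (coeffA t q x) (coeffB t q x) (ρ₁ 0) (ρ₂ 0) ∧
    (∀ i : Fin n,
      HasExponentsAt (coeffA t q x) (coeffB t q x) (t i) (ρ₁ i.succ) (ρ₂ i.succ)) ∧
    ∀ j : Fin N, IsApparentSingularity (coeffA t q x) (coeffB t q x) (q j)}

/-- `p_j = lim_{z → q_j} (z - q_j) H(z) / ψ(z)²` for every `j`. -/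
def HasMomenta (t : Fin n → ℂ) (q : Fin N → ℂ) (x : CoeffSpace n N) (p : Fin N → ℂ) : Prop :=
  ∀ j, Tendsto (fun z => (z - q j) * coeffB t q x z) (𝓝[≠] (q j)) (𝓝 (p j))

/-- The equations of the space whose momenta are `p`. -/
def equationsWithMomenta (t : Fin n → ℂ) (q : Fin N → ℂ) (ρ₁ ρ₂ : Fin (n + 1) → ℂ)
    (p : Fin N → ℂ) : Set (CoeffSpace n N) :=
  {x | x ∈ equationSpace t q ρ₁ ρ₂ ∧ HasMomenta t q x p}

/-! ### The linear system on the coefficients of `H` -/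

/-- Rows of the system: the point at infinity, the points `t_i`, and three rows for each `q_j`. -/
abbrev RowIndex (n N : ℕ) : Type := Unit ⊕ Fin n ⊕ Fin N ⊕ Fin N ⊕ Fin N

/-- The confluent Vandermonde matrix sending `(H_0, …, H_{2(n+N-1)})` to the top coefficient
`H_{2(n+N-1)}`, the values `H(t_i)`, `H(q_j)` and the derivatives `H'(q_j)`, `H''(q_j)`. -/
def systemMatrix (t : Fin n → ℂ) (q : Fin N → ℂ) :
    Matrix (RowIndex n N) (Fin (2 * (n + N) - 1)) ℂ
  | .inl _, m => if (m : ℕ) = 2 * (n + N - 1) then 1 else 0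
  | .inr (.inl i), m => t i ^ (m : ℕ)
  | .inr (.inr (.inl j)), m => q j ^ (m : ℕ)
  | .inr (.inr (.inr (.inl j))), m => (m : ℕ) * q j ^ ((m : ℕ) - 1)
  | .inr (.inr (.inr (.inr j))), m => (m : ℕ) * (((m : ℕ) : ℂ) - 1) * q j ^ ((m : ℕ) - 2)

/-- `μ_j = 1 / (∏_i (q_j - t_i)² ∏_{k ≠ j} (q_j - q_k)²)`. -/
def mu (t : Fin n → ℂ) (q : Fin N → ℂ) (j : Fin N) : ℂ :=
  1 / ((∏ i, (q j - t i) ^ 2) * ∏ k ∈ Finset.univ.erase j, (q j - q k) ^ 2)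

/-- The right-hand side `(r, β_i, 0, p_j / μ_j, δ_j p_j² + ε_j p_j)` of the system. -/
def systemRhs (t : Fin n → ℂ) (q : Fin N → ℂ) (r : ℂ) (β : Fin n → ℂ) (δ ε p : Fin N → ℂ) :
    RowIndex n N → ℂ
  | .inl _ => r
  | .inr (.inl i) => β i
  | .inr (.inr (.inl _)) => 0
  | .inr (.inr (.inr (.inl j))) => p j / mu t q j
  | .inr (.inr (.inr (.inr j))) => δ j * p j ^ 2 + ε j * p j

/-! ### Algebraic subsets of affine space -/

/-- `V` is an algebraic subset of the affine space `ℂ^σ`. -/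
def IsAlgebraicSet {σ : Type} (V : Set (σ → ℂ)) : Prop :=
  ∃ I : Ideal (MvPolynomial σ ℂ), V = {x | ∀ f ∈ I, MvPolynomial.eval x f = 0}

/-- The dimension of an algebraic subset of affine space: the Krull dimension of its
coordinate ring `ℂ[σ] / I(V)` (it is `⊥` for the empty set). -/
def algDim {σ : Type} (V : Set (σ → ℂ)) : WithBot ℕ∞ :=
  ringKrullDim (MvPolynomial σ ℂ ⧸ MvPolynomial.vanishingIdeal ℂ V)

end

end Fuchs

namespace Fuchs

noncomputable section

/-! ### Krull dimension and integral extensions -/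

/-! The exponents at the `t_i`, and the exponents `0, 2` at the `q_j`, prescribe the residues of `G
/ ψ` at all `n + N` finite singular points. As `deg G < n + N`, Lagrange interpolation gives exactly
one such `G`. Its top coefficient is the sum of the residues, and Fuchs' relation says that this is
the value required at infinity (`coeff_fixedG`).

Write `ψ = (z - q_j) Φ`. By Frobenius' method a logarithm at `q_j` can only enter at order two, so a
single condition excludes it (`isApparentSingularity_iff`). With `H'(q_j) = p_j Φ(q_j)²` this
condition reads `H''(q_j) = δ_j p_j² + ε_j p_j`, so for given `p` all conditions on `H` are linear
(`mem_equationsWithMomenta_iff`).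

Without the rows for `H''`, the homogeneous system has the solutions `D T`, where `D = ∏ (z - t_i) ∏
(z - q_j)²` and `deg T < n - 2`; moreover `(D T)''(q_j) = D''(q_j) T(q_j)` with `D''(q_j) ≠ 0`.
Hence solving for `H` means finding `T` whose value at each `q_j` is `κ_j p_j²` plus an affine
function of `p`, with `κ_j ≠ 0` (`exists_parametrization`). If `N ≤ n - 2` this is always possible.
Otherwise the first `n - 2` values determine `T`, and matching the remaining ones gives the
constraints on `p` (`exists_interpolation_iff`).

For the dimensions, split the variables into `x` and `y` so that the `k`-th equation is a nonzero
multiple of `y_k²` up to terms affine in `y` over `ℂ[x]`. Then the polynomial ring is integral over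
the subalgebra generated by `x` and the equations; these generators are algebraically independent by
counting, and modulo the equations the ring is integral over `ℂ[x]`
(`HasSeparatedSquares.algDim_zeros`). Taking `x = T`, `y = p` gives the dimension of the space of
equations; taking for `x` the first `n - 2` momenta gives that of the set of admissible momenta. -/

theorem ringKrullDim_eq_of_isIntegral {R S : Type*} [CommRing R] [CommRing S] (f : R →+* S)
    (hf : Function.Injective f) (hfi : f.IsIntegral) : ringKrullDim R = ringKrullDim S := by
  algebraize [f]
  have : Algebra.IsIntegral R S := ⟨hfi⟩
  apply le_antisymm
  -- Lying over supplies a prime above the bottom of a chain, and going up lifts the rest of it.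
  · refine iSup_le fun l => ?_
    have hker : (⊥ : Ideal S).comap (algebraMap R S) ≤ l.head.asIdeal := by
      intro x hx
      have hx' : f x = 0 := hx
      rw [(injective_iff_map_eq_zero f).mp hf x hx']
      exact zero_mem _
    obtain ⟨Q, -, hQ, hQl⟩ :=
      Ideal.exists_ideal_over_prime_of_isIntegral l.head.asIdeal (⊥ : Ideal S) hker
    have : Q.LiesOver l.head.asIdeal := ⟨hQl.symm⟩
    obtain ⟨L, hL, -, -⟩ := Ideal.exists_ltSeries_of_hasGoingUp l Q
    rw [← hL]
    exact le_iSup (fun p : LTSeries (PrimeSpectrum S) => ((p.length : ℕ∞) : WithBot ℕ∞)) L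
  -- Incomparability: contraction of primes along an integral extension is strictly monotone.
  · refine Order.krullDim_le_of_strictMono (PrimeSpectrum.comap (algebraMap R S)) ?_
    intro P Q hPQ
    exact Ideal.IsIntegral.comap_lt_comap (R := R) (I := P.asIdeal) (J := Q.asIdeal) hPQ

/-- If the square of each of finitely many elements is a linear combination of the elements
and `1`, then these elements are integral. -/
theorem isIntegral_of_sq_mem_span {R A κ : Type*} [CommRing R] [CommRing A] [IsDomain A]
    [Algebra R A] [Finite κ] (y : κ → A)
    (hy : ∀ k, y k ^ 2 ∈ Submodule.span R (insert 1 (Set.range y))) (k : κ) :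
    IsIntegral R (y k) := by
  classical
  -- The squarefree monomials span a finite module containing `1`; its stability under every `y k`
  -- gives integrality.
  let M : Submodule R A := Submodule.span R (Set.range fun s : Finset κ => ∏ i ∈ s, y i)
  have hmem (s : Finset κ) : ∏ i ∈ s, y i ∈ M := Submodule.subset_span ⟨s, rfl⟩
  have key (m : ℕ) : ∀ s : Finset κ, s.card = m → ∀ k, y k * ∏ i ∈ s, y i ∈ M := by
    induction m using Nat.strong_induction_on with
    | _ m ih =>
      intro s hs k
      -- A repeated factor `y k ^ 2` is replaced by a linear combination of `1` and the `y l`, each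
      -- multiplied by the shorter monomial over `s.erase k`, where induction applies.
      by_cases hk : k ∈ s
      · have hlt : (s.erase k).card < m := hs ▸ Finset.card_erase_lt_of_mem hk
        have hsq : y k * ∏ i ∈ s, y i = y k ^ 2 * ∏ i ∈ s.erase k, y i := by
          rw [← Finset.mul_prod_erase s y hk]; ring
        rw [hsq]
        have hsp := hy k
        generalize y k ^ 2 = z at hsp ⊢
        induction hsp using Submodule.span_induction with
        | mem x hx =>
          rcases hx with rfl | ⟨l, rfl⟩
          · simpa using hmem _
          · exact ih _ hlt _ rfl l
        | zero => simp
        | add x z _ _ hx hz => rw [add_mul]; exact M.add_mem hx hz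
        | smul r x _ hx => rw [smul_mul_assoc]; exact M.smul_mem r hx
      · rw [← Finset.prod_insert hk]
        exact hmem _
  refine isIntegral_of_smul_mem_submodule M ?_ ?_ (y k) ?_
  · intro h
    have h1 : (1 : A) ∈ M := by simpa using hmem ∅
    rw [h] at h1
    exact one_ne_zero ((Submodule.mem_bot R).mp h1)
  · exact Submodule.fg_span (Set.finite_range _)
  · intro x hx
    rw [smul_eq_mul]
    induction hx using Submodule.span_induction with
    | mem x hx => obtain ⟨s, rfl⟩ := hx; exact key _ s rfl k
    | zero => simp
    | add x z _ _ hx hz => rw [mul_add]; exact M.add_mem hx hz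
    | smul r x _ hx => rw [mul_smul_comm]; exact M.smul_mem r hx

/-! ### Systems of quadratic equations with separated squares -/

section QuadraticSystem

open MvPolynomial

variable {ι κ σ : Type} [Finite κ] (e : ι ⊕ κ ≃ σ) (F : κ → MvPolynomial σ ℂ)

/-- In the variables `x = X ∘ e ∘ inl`, `y = X ∘ e ∘ inr`, the polynomial `F k` is a nonzero
multiple of `y k ^ 2` up to terms of degree at most one in `y`. -/
def HasSeparatedSquares : Prop :=
  ∀ k, ∃ c : ℂ, ∃ r : MvPolynomial ι ℂ, ∃ s : κ →₀ MvPolynomial ι ℂ,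
    X (e (.inr k)) ^ 2 = C c * F k + rename (e ∘ .inl) r +
      s.sum fun l a => rename (e ∘ .inl) a * X (e (.inr l))

/-- The family consisting of the variables `x` and the polynomials `F`. -/
def paramSystem : ι ⊕ κ → MvPolynomial σ ℂ := Sum.elim (fun i => X (e (.inl i))) F

variable {e F}

/-- Over the subalgebra the `F k` and all polynomials in `x` are scalars, so each `y k ^ 2` is a
linear combination of `1` and the `y l`, and `isIntegral_of_sq_mem_span` applies. -/
theorem HasSeparatedSquares.isIntegral_adjoin (hF : HasSeparatedSquares e F) :
    Algebra.IsIntegral (Algebra.adjoin ℂ (Set.range (paramSystem e F))) (MvPolynomial σ ℂ) := by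
  set B := Algebra.adjoin ℂ (Set.range (paramSystem e F)) with hB
  have hxB (r : MvPolynomial ι ℂ) : rename (e ∘ .inl) r ∈ B := by
    induction r using MvPolynomial.induction_on with
    | C a => simpa using B.algebraMap_mem a
    | add p q hp hq => simpa using B.add_mem hp hq
    | mul_X p i hp =>
      have hi : X (e (.inl i)) ∈ B := Algebra.subset_adjoin ⟨.inl i, rfl⟩
      simpa using B.mul_mem hp hi
  have hFB (k : κ) : F k ∈ B := Algebra.subset_adjoin ⟨.inr k, rfl⟩
  have hy (k : κ) : IsIntegral B (X (e (.inr k)) : MvPolynomial σ ℂ) := by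
    refine isIntegral_of_sq_mem_span (R := B) (fun k => X (e (.inr k))) (fun k => ?_) k
    obtain ⟨c, r, s, h⟩ := hF k
    rw [h]
    have hc : C c * F k + rename (e ∘ .inl) r ∈ B :=
      B.add_mem (B.mul_mem (B.algebraMap_mem c) (hFB k)) (hxB r)
    refine Submodule.add_mem _ ?_ (Submodule.sum_mem _ fun l _ => ?_)
    · have := Submodule.smul_mem (Submodule.span B (insert (1 : MvPolynomial σ ℂ)
        (Set.range fun k => X (e (.inr k))))) ⟨_, hc⟩ (Submodule.subset_span (Set.mem_insert _ _))
      simpa [Subalgebra.smul_def] using this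
    · have := Submodule.smul_mem (Submodule.span B (insert (1 : MvPolynomial σ ℂ)
        (Set.range fun k => X (e (.inr k))))) ⟨_, hxB (s l)⟩
        (Submodule.subset_span (Set.mem_insert_of_mem _ ⟨l, rfl⟩))
      simpa [Subalgebra.smul_def] using this
  refine ⟨fun p => ?_⟩
  induction p using MvPolynomial.induction_on with
  | C a => exact isIntegral_algebraMap (R := B) (x := algebraMap ℂ B a)
  | add p q hp hq => exact hp.add hq
  | mul_X p i hp =>
    refine hp.mul ?_
    obtain ⟨j, rfl⟩ := e.surjective i
    rcases j with j | j
    · exact isIntegral_algebraMap (R := B) (x := ⟨_, Algebra.subset_adjoin ⟨.inl j, rfl⟩⟩)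
    · exact hy j

/-- The polynomial ring is algebraic over the subalgebra generated by the family, and the family has
as many members as the transcendence degree; it must therefore be a transcendence basis. -/
theorem HasSeparatedSquares.algebraicIndependent_paramSystem [Finite ι]
    (hF : HasSeparatedSquares e F) : AlgebraicIndependent ℂ (paramSystem e F) := by
  have := hF.isIntegral_adjoin
  have : Finite (ι ⊕ κ) := inferInstance
  have hb : IsTranscendenceBasis ℂ (paramSystem e F) := by
    apply Algebra.IsAlgebraic.isTranscendenceBasis_of_le_trdeg_of_finite
    rw [MvPolynomial.trdeg_of_isDomain, Cardinal.lift_id, Cardinal.mk_congr e]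
  exact hb.1

theorem HasSeparatedSquares.algebraicIndependent [Finite ι] (hF : HasSeparatedSquares e F) :
    AlgebraicIndependent ℂ F :=
  hF.algebraicIndependent_paramSystem.comp Sum.inr Sum.inr_injective

theorem HasSeparatedSquares.isIntegral_aeval (hF : HasSeparatedSquares e F) :
    (aeval (R := ℂ) (paramSystem e F)).toRingHom.IsIntegral := by
  have := hF.isIntegral_adjoin
  intro p
  have h := this.isIntegral p
  obtain ⟨P, hP, hP0⟩ := h
  have hsurj : Function.Surjective (aeval (R := ℂ) (paramSystem e F)).rangeRestrict :=
    AlgHom.rangeRestrict_surjective _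
  have hrange : Algebra.adjoin ℂ (Set.range (paramSystem e F)) =
      (aeval (R := ℂ) (paramSystem e F)).range := Algebra.adjoin_range_eq_range_aeval _ _
  let g : MvPolynomial (ι ⊕ κ) ℂ →+* Algebra.adjoin ℂ (Set.range (paramSystem e F)) :=
    (Subalgebra.equivOfEq _ _ hrange.symm).toAlgHom.toRingHom.comp
      (aeval (R := ℂ) (paramSystem e F)).rangeRestrict.toRingHom
  have hg : Function.Surjective g :=
    (Subalgebra.equivOfEq _ _ hrange.symm).surjective.comp hsurj
  have hcomp : (aeval (R := ℂ) (paramSystem e F)).toRingHom =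
      (algebraMap (Algebra.adjoin ℂ (Set.range (paramSystem e F))) (MvPolynomial σ ℂ)).comp g := by
    ext <;> rfl
  rw [hcomp]
  exact (RingHom.IsIntegral.trans g _ (RingHom.isIntegral_of_surjective g hg)
    fun x => this.isIntegral x) p

/-- By the Nullstellensatz the vanishing ideal is the radical of `(F)`. The substitution `φ` is an
integral extension, and modulo `F` it factors through the projection `π` that kills the variables of
`κ`. This makes the coordinate ring an integral extension of `ℂ[x]`, whose dimension is the number
of variables `x`. -/
theorem HasSeparatedSquares.algDim_zeros [Finite ι] (hF : HasSeparatedSquares e F) :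
    algDim {v : σ → ℂ | ∀ k, eval v (F k) = 0} = (Nat.card ι : WithBot ℕ∞) := by
  have : Finite σ := Finite.of_equiv _ e
  set Z := {v : σ → ℂ | ∀ k, eval v (F k) = 0} with hZ
  have hZl : Z = zeroLocus ℂ (Ideal.span (Set.range F)) := by
    rw [zeroLocus_span]
    ext v
    simp [hZ, aeval_eq_eval]
  have hvan : vanishingIdeal ℂ Z = (Ideal.span (Set.range F)).radical := by
    rw [hZl, vanishingIdeal_zeroLocus_eq_radical]
  let φ : MvPolynomial (ι ⊕ κ) ℂ →ₐ[ℂ] MvPolynomial σ ℂ := aeval (paramSystem e F)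
  let π : MvPolynomial (ι ⊕ κ) ℂ →ₐ[ℂ] MvPolynomial ι ℂ := aeval (Sum.elim X 0)
  let ξ : MvPolynomial ι ℂ →ₐ[ℂ] MvPolynomial σ ℂ := rename (e ∘ .inl)
  let mk := Ideal.Quotient.mk (vanishingIdeal ℂ Z)
  have hφξ (f : MvPolynomial ι ℂ) : φ (rename .inl f) = ξ f := by
    induction f using MvPolynomial.induction_on with
    | C a => simp [φ, ξ]
    | add p q hp hq => simp [hp, hq]
    | mul_X p i hp => rw [map_mul, map_mul, hp]; simp [φ, ξ, paramSystem]
  have hπ (f : MvPolynomial ι ℂ) : π (rename .inl f) = f := by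
    induction f using MvPolynomial.induction_on with
    | C a => simp [π]
    | add p q hp hq => simp [hp, hq]
    | mul_X p i hp => rw [map_mul, map_mul, hp]; simp [π]
  have hFmem (k : κ) : F k ∈ vanishingIdeal ℂ Z := by
    rw [hvan]
    exact Ideal.le_radical (Ideal.subset_span ⟨k, rfl⟩)
  have hcomp : mk.comp φ.toRingHom = (mk.comp ξ.toRingHom).comp π.toRingHom := by
    apply MvPolynomial.ringHom_ext
    · intro a
      simp [φ, π, ξ]
    · rintro (i | k)
      · simp [φ, π, ξ, paramSystem]
      · simp only [φ, π, ξ, paramSystem, AlgHom.toRingHom_eq_coe, RingHom.coe_comp,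
          RingHom.coe_coe, Function.comp_apply, aeval_X, Sum.elim_inr, Pi.zero_apply, map_zero]
        exact Ideal.Quotient.eq_zero_iff_mem.mpr (hFmem k)
  have hfi : (mk.comp ξ.toRingHom).IsIntegral := by
    apply RingHom.IsIntegral.tower_top π.toRingHom
    rw [← hcomp]
    exact RingHom.IsIntegral.trans _ _ hF.isIntegral_aeval
      (RingHom.isIntegral_of_surjective _ Ideal.Quotient.mk_surjective)
  -- Lying over for the prime `ker π` yields a prime `Q` that contains all `F k`, hence the
  -- vanishing ideal, and meets `ℂ[x]` only in zero.
  have hinj : Function.Injective (mk.comp ξ.toRingHom) := by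
    rw [injective_iff_map_eq_zero]
    intro f hf
    have hf' : ξ f ∈ vanishingIdeal ℂ Z := Ideal.Quotient.eq_zero_iff_mem.mp hf
    algebraize [φ.toRingHom]
    have : Algebra.IsIntegral (MvPolynomial (ι ⊕ κ) ℂ) (MvPolynomial σ ℂ) :=
      ⟨hF.isIntegral_aeval⟩
    have hJ : (RingHom.ker π.toRingHom).IsPrime := RingHom.ker_isPrime _
    obtain ⟨Q, -, hQ, hQJ⟩ := Ideal.exists_ideal_over_prime_of_isIntegral
      (S := MvPolynomial σ ℂ) (RingHom.ker π.toRingHom) ⊥ (by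
        intro x hx
        have hx0 : φ x = 0 := hx
        rw [(injective_iff_map_eq_zero φ).mp hF.algebraicIndependent_paramSystem x hx0]
        exact zero_mem _)
    have hmemQ (x : MvPolynomial (ι ⊕ κ) ℂ) : φ x ∈ Q ↔ π x = 0 := by
      have h : x ∈ Ideal.comap (algebraMap _ (MvPolynomial σ ℂ)) Q ↔
          x ∈ RingHom.ker π.toRingHom := by rw [hQJ]
      exact h
    have hFQ : vanishingIdeal ℂ Z ≤ Q := by
      rw [hvan, hQ.radical_le_iff, Ideal.span_le]
      rintro _ ⟨k, rfl⟩
      have := (hmemQ (X (.inr k))).mpr (by simp [π])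
      simpa [φ, paramSystem] using this
    have h0 := (hmemQ (rename .inl f)).mp (by rw [hφξ]; exact hFQ hf')
    rwa [hπ f] at h0
  rw [algDim, ← ringKrullDim_eq_of_isIntegral _ hinj hfi]
  simp

end QuadraticSystem

/-! ### Affine functions and affine embeddings -/

section Affine

open MvPolynomial

variable {σ τ : Type}

/-- The polynomial of degree at most one defining the affine function `v ↦ c + ℓ v`. -/
def affinePoly [Fintype σ] [DecidableEq σ] (c : ℂ) (ℓ : (σ → ℂ) →ₗ[ℂ] ℂ) : MvPolynomial σ ℂ :=
  C c + ∑ i, C (ℓ (Pi.single i 1)) * X i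

@[simp]
theorem eval_affinePoly [Fintype σ] [DecidableEq σ] (c : ℂ) (ℓ : (σ → ℂ) →ₗ[ℂ] ℂ) (v : σ → ℂ) :
    eval v (affinePoly c ℓ) = c + ℓ v := by
  have hv : v = ∑ i, v i • Pi.single i (1 : ℂ) := by
    simpa using (pi_eq_sum_univ' v)
  conv_rhs => rw [hv, map_sum]
  simp only [affinePoly, map_add, eval_C, map_sum, map_mul, eval_X, map_smul, smul_eq_mul,
    mul_comm]

/-- The map between affine spaces given by a family of polynomials. -/
def polyMap (A : τ → MvPolynomial σ ℂ) (v : σ → ℂ) : τ → ℂ := fun j => eval v (A j)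

theorem eval_bind₁_eq (A : τ → MvPolynomial σ ℂ) (g : MvPolynomial τ ℂ) (v : σ → ℂ) :
    eval v (bind₁ A g) = eval (polyMap A v) g := by
  simp only [← aeval_eq_eval, aeval_bind₁]
  rfl

theorem isAlgebraicSet_setOf_forall {ι : Type*} (f : ι → MvPolynomial σ ℂ) :
    IsAlgebraicSet {v | ∀ i, eval v (f i) = 0} := by
  refine ⟨Ideal.span (Set.range f), ?_⟩
  have := zeroLocus_span (K := ℂ) (Set.range f)
  ext v
  have h := congrArg (v ∈ ·) this
  simp only [mem_zeroLocus_iff, aeval_eq_eval] at h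
  simpa using h.symm

/-- A point `x` is in the image exactly when `B x` satisfies the equations `f` and `x = A (B x)`;
both are polynomial conditions. -/
theorem isAlgebraicSet_image_polyMap {ι : Type*} (f : ι → MvPolynomial σ ℂ)
    (A : τ → MvPolynomial σ ℂ) (B : σ → MvPolynomial τ ℂ)
    (hBA : Function.LeftInverse (polyMap B) (polyMap A)) :
    IsAlgebraicSet (polyMap A '' {v | ∀ i, eval v (f i) = 0}) := by
  have : polyMap A '' {v | ∀ i, eval v (f i) = 0} = {x | ∀ i : ι ⊕ τ, eval x
      (Sum.elim (fun i => bind₁ B (f i)) (fun j => X j - bind₁ B (A j)) i) = 0} := by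
    ext x
    simp only [Set.mem_image, Set.mem_ofPred_eq, Sum.forall, Sum.elim_inl, Sum.elim_inr, map_sub,
      eval_X, eval_bind₁_eq, sub_eq_zero]
    constructor
    · rintro ⟨v, hv, rfl⟩
      rw [hBA v]
      exact ⟨hv, fun j => rfl⟩
    · rintro ⟨h1, h2⟩
      exact ⟨polyMap B x, h1, funext fun j => (h2 j).symm⟩
  rw [this]
  exact isAlgebraicSet_setOf_forall _

/-- Pullback along `A` is surjective on polynomials because `B` inverts it, and it carries precisely
the vanishing ideal of the image into that of `Z`; the coordinate rings are isomorphic. -/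
theorem algDim_image_polyMap (Z : Set (σ → ℂ))
    (A : τ → MvPolynomial σ ℂ) (B : σ → MvPolynomial τ ℂ)
    (hBA : Function.LeftInverse (polyMap B) (polyMap A)) :
    algDim (polyMap A '' Z) = algDim Z := by
  have hsurj : Function.Surjective (bind₁ A) := by
    intro g
    refine ⟨bind₁ B g, MvPolynomial.funext fun v => ?_⟩
    rw [eval_bind₁_eq, eval_bind₁_eq, hBA v]
  have hker : RingHom.ker ((Ideal.Quotient.mk (vanishingIdeal ℂ Z)).comp (bind₁ A).toRingHom) =
      vanishingIdeal ℂ (polyMap A '' Z) := by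
    ext g
    rw [RingHom.mem_ker, RingHom.comp_apply, Ideal.Quotient.eq_zero_iff_mem]
    simp only [mem_vanishingIdeal_iff, Set.forall_mem_image, aeval_eq_eval,
      ← eval_bind₁_eq]
    rfl
  rw [algDim, algDim, ← hker]
  exact ringKrullDim_eq_of_ringEquiv (RingHom.quotientKerEquivOfSurjective
    (Ideal.Quotient.mk_surjective.comp hsurj))

/-- An injective affine map is polynomial and has a polynomial left inverse. -/
theorem exists_polyMap_of_injective [Fintype σ] [Fintype τ] (a : τ → ℂ)
    (L : (σ → ℂ) →ₗ[ℂ] (τ → ℂ)) (hL : Function.Injective L) :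
    ∃ (A : τ → MvPolynomial σ ℂ) (B : σ → MvPolynomial τ ℂ),
      polyMap A = (fun v => a + L v) ∧ Function.LeftInverse (polyMap B) (polyMap A) := by
  classical
  obtain ⟨K, hK⟩ := L.exists_leftInverse_of_injective (LinearMap.ker_eq_bot.mpr hL)
  have hKL (v : σ → ℂ) : K (L v) = v := LinearMap.congr_fun hK v
  refine ⟨fun j => affinePoly (a j) (LinearMap.proj j ∘ₗ L),
    fun i => affinePoly (-(K a i)) (LinearMap.proj i ∘ₗ K), ?_, fun v => ?_⟩
  · ext v j
    simp [polyMap]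
  · have h : polyMap (fun j => affinePoly (a j) (LinearMap.proj j ∘ₗ L)) v = a + L v := by
      ext j
      simp [polyMap]
    rw [h]
    ext i
    simp [polyMap, hKL]

end Affine

/-! ### Taylor series -/

/-- The Taylor series of `f` at `c`. -/
def taylorSeries (c : ℂ) (f : ℂ → ℂ) : PowerSeries ℂ :=
  PowerSeries.mk fun k => iteratedDeriv k f c / (k.factorial : ℂ)

section TaylorSeries

variable {c : ℂ} {f g : ℂ → ℂ}

theorem coeff_taylorSeries (c : ℂ) (f : ℂ → ℂ) (k : ℕ) :
    (taylorSeries c f).coeff k = iteratedDeriv k f c / (k.factorial : ℂ) := by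
  simp [taylorSeries]

theorem taylorSeries_congr (h : f =ᶠ[𝓝 c] g) : taylorSeries c f = taylorSeries c g := by
  ext k
  rw [coeff_taylorSeries, coeff_taylorSeries, h.iteratedDeriv_eq]

theorem taylorSeries_add (hf : AnalyticAt ℂ f c) (hg : AnalyticAt ℂ g c) :
    taylorSeries c (f + g) = taylorSeries c f + taylorSeries c g := by
  ext k
  simp only [coeff_taylorSeries, map_add]
  rw [iteratedDeriv_add hf.contDiffAt hg.contDiffAt, add_div]

theorem taylorSeries_mul (hf : AnalyticAt ℂ f c) (hg : AnalyticAt ℂ g c) :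
    taylorSeries c (f * g) = taylorSeries c f * taylorSeries c g := by
  ext k
  simp only [coeff_taylorSeries, PowerSeries.coeff_mul]
  rw [iteratedDeriv_mul hf.contDiffAt hg.contDiffAt, Finset.sum_div,
    Finset.Nat.sum_antidiagonal_eq_sum_range_succ
      (fun i j => iteratedDeriv i f c / (i.factorial : ℂ) *
        (iteratedDeriv j g c / (j.factorial : ℂ)))]
  refine Finset.sum_congr rfl fun i hi => ?_
  have hik : i ≤ k := Nat.lt_succ_iff.mp (Finset.mem_range.mp hi)
  have h1 : (i.factorial : ℂ) ≠ 0 := by exact_mod_cast i.factorial_ne_zero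
  have h2 : ((k - i).factorial : ℂ) ≠ 0 := by exact_mod_cast (k - i).factorial_ne_zero
  have h3 : (k.factorial : ℂ) ≠ 0 := by exact_mod_cast k.factorial_ne_zero
  have h4 : ((k.choose i : ℕ) : ℂ) * i.factorial * (k - i).factorial = k.factorial := by
    exact_mod_cast Nat.choose_mul_factorial_mul_factorial hik
  field_simp
  rw [← h4]
  ring

theorem taylorSeries_pow (hf : AnalyticAt ℂ f c) (m : ℕ) :
    taylorSeries c (f ^ (m + 1)) = taylorSeries c f ^ (m + 1) := by
  induction m with
  | zero => simp
  | succ m ih => rw [pow_succ f, taylorSeries_mul (hf.pow _) hf, ih, pow_succ _ (m + 1)]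

theorem taylorSeries_deriv (c : ℂ) (f : ℂ → ℂ) :
    taylorSeries c (deriv f) = PowerSeries.derivative ℂ (taylorSeries c f) := by
  ext k
  rw [PowerSeries.coeff_derivative, coeff_taylorSeries, coeff_taylorSeries, iteratedDeriv_succ',
    Nat.factorial_succ]
  have h3 : (k.factorial : ℂ) ≠ 0 := by exact_mod_cast k.factorial_ne_zero
  have h4 : (k : ℂ) + 1 ≠ 0 := by exact_mod_cast k.succ_ne_zero
  push_cast
  field_simp

theorem taylorSeries_sub_const (c : ℂ) : taylorSeries c (fun z => z - c) = PowerSeries.X := by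
  ext k
  rw [coeff_taylorSeries, PowerSeries.coeff_X]
  rcases k with _ | _ | k
  · simp
  · simp
  · simp [iteratedDeriv_succ']

theorem taylorSeries_eq_X_sq_mul (hg : AnalyticAt ℂ g c)
    (h : ∀ᶠ z in 𝓝 c, f z = (z - c) ^ 2 * g z) :
    taylorSeries c f = PowerSeries.X ^ 2 * taylorSeries c g := by
  have hs : AnalyticAt ℂ (fun z => z - c) c := by fun_prop
  have hfg : f =ᶠ[𝓝 c] (fun z => z - c) ^ 2 * g := h
  rw [taylorSeries_congr hfg, taylorSeries_mul (hs.pow 2) hg, taylorSeries_pow hs 1,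
    taylorSeries_sub_const]

theorem hasFPowerSeriesAt_taylorSeries (hf : AnalyticAt ℂ f c) :
    HasFPowerSeriesAt f (FormalMultilinearSeries.ofScalars ℂ fun k => (taylorSeries c f).coeff k)
      c := by
  simpa only [coeff_taylorSeries] using hf.hasFPowerSeriesAt

theorem eventually_eq_zero_of_taylorSeries_eq_zero (hf : AnalyticAt ℂ f c)
    (h : taylorSeries c f = 0) : ∀ᶠ z in 𝓝 c, f z = 0 := by
  have hp := hasFPowerSeriesAt_taylorSeries hf
  simp only [h, map_zero] at hp
  have h0 : FormalMultilinearSeries.ofScalars ℂ (fun _ : ℕ => (0 : ℂ)) = 0 :=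
    (FormalMultilinearSeries.ofScalars_series_eq_zero ℂ).mpr rfl
  rw [h0] at hp
  exact hp.eventually_eq_zero

theorem exists_norm_coeff_taylorSeries_le (hf : AnalyticAt ℂ f c) :
    ∃ C > 0, ∃ r > 0, ∀ k, ‖(taylorSeries c f).coeff k‖ ≤ C * r ^ k := by
  obtain ⟨C, r, hC, hr, h⟩ :=
    FormalMultilinearSeries.le_mul_pow_of_radius_pos _
      (hasFPowerSeriesAt_taylorSeries hf).radius_pos
  refine ⟨C, hC, r, hr, fun k => ?_⟩
  simpa [FormalMultilinearSeries.ofScalars_norm] using h k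

/-- The bound forces a radius of convergence of at least `K⁻¹`. This is the passage from formal to
holomorphic solutions. -/
theorem exists_analyticAt_taylorSeries_eq (c : ℂ) (u : ℕ → ℂ) {D K : ℝ} (hK : 0 < K)
    (hu : ∀ k, ‖u k‖ ≤ D * K ^ k) :
    ∃ w : ℂ → ℂ, AnalyticAt ℂ w c ∧ taylorSeries c w = PowerSeries.mk u := by
  set p := FormalMultilinearSeries.ofScalars ℂ u with hp
  have hrad : 0 < p.radius := by
    have hle : ((K⁻¹.toNNReal : NNReal) : ENNReal) ≤ p.radius := by
      refine p.le_radius_of_bound D fun k => ?_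
      rw [hp, FormalMultilinearSeries.ofScalars_norm, Real.coe_toNNReal _ (by positivity)]
      calc ‖u k‖ * (K⁻¹) ^ k ≤ D * K ^ k * (K⁻¹) ^ k := by gcongr; exact hu k
        _ = D := by rw [mul_assoc, ← mul_pow, mul_inv_cancel₀ hK.ne', one_pow, mul_one]
    refine lt_of_lt_of_le ?_ hle
    rw [ENNReal.coe_pos, Real.toNNReal_pos]
    exact inv_pos.mpr hK
  have hw : HasFPowerSeriesAt (fun z => p.sum (z - c)) p c := by
    have := (p.hasFPowerSeriesOnBall hrad).comp_sub c
    rw [zero_add] at this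
    exact this.hasFPowerSeriesAt
  refine ⟨_, hw.analyticAt, ?_⟩
  have h := hw.eq_formalMultilinearSeries (hasFPowerSeriesAt_taylorSeries hw.analyticAt)
  have h' := FormalMultilinearSeries.ofScalars_series_injective ℂ ℂ h
  ext k
  rw [PowerSeries.coeff_mk]
  exact (congrFun h' k).symm

end TaylorSeries

/-! ### The Frobenius method at exponents `0` and `2` -/

/-- The left-hand side of the equation `X² P u'' + X Q u' + R u = 0` for formal power series. -/
def eulerOp (P Q R u : PowerSeries ℂ) : PowerSeries ℂ :=
  PowerSeries.X ^ 2 * PowerSeries.derivative ℂ (PowerSeries.derivative ℂ u) * P +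
    PowerSeries.X * PowerSeries.derivative ℂ u * Q + u * R

/-- `X d/dX` and `X² d²/dX²` multiply the `j`-th coefficient by `j` and `j (j - 1)`, so the equation
becomes the Frobenius recursion. -/
theorem coeff_eulerOp (P Q R u : PowerSeries ℂ) (k : ℕ) :
    (eulerOp P Q R u).coeff k = ∑ j ∈ Finset.range (k + 1),
      (P.coeff (k - j) * ((j : ℂ) * (j - 1)) + Q.coeff (k - j) * j + R.coeff (k - j)) *
        u.coeff j := by
  have h1 (j : ℕ) : (PowerSeries.X * PowerSeries.derivative ℂ u).coeff j = j * u.coeff j := by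
    rcases j with _ | j
    · simp
    · rw [PowerSeries.coeff_succ_X_mul, PowerSeries.coeff_derivative]
      push_cast
      ring
  have h2 (j : ℕ) : (PowerSeries.X ^ 2 * PowerSeries.derivative ℂ
      (PowerSeries.derivative ℂ u)).coeff j = j * (j - 1) * u.coeff j := by
    rcases j with _ | _ | j
    · simp [PowerSeries.coeff_X_pow_mul']
    · simp [PowerSeries.coeff_X_pow_mul']
    · rw [show j + 1 + 1 = j + 2 from rfl, PowerSeries.coeff_X_pow_mul,
        PowerSeries.coeff_derivative, PowerSeries.coeff_derivative]
      push_cast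
      ring
  simp only [eulerOp, map_add, PowerSeries.coeff_mul _ _ P, PowerSeries.coeff_mul _ _ Q,
    PowerSeries.coeff_mul _ _ R, h1, h2, ← Finset.sum_add_distrib]
  rw [Finset.Nat.sum_antidiagonal_eq_sum_range_succ_mk]
  exact Finset.sum_congr rfl fun j _ => by ring

/-- The coefficients of the formal solution with prescribed coefficients of order `≤ 2` of
`X² P u'' + X Q u' + R u = 0`, where `0` and `2` are the roots of the indicial equation. -/
def frobeniusSeq (P Q R : PowerSeries ℂ) (a₀ a₁ a₂ : ℂ) : ℕ → ℂ
  | 0 => a₀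
  | 1 => a₁
  | 2 => a₂
  | k + 3 => -(∑ j : Fin (k + 3),
      (P.coeff (k + 3 - j) * (((j : ℕ) : ℂ) * ((j : ℕ) - 1)) + Q.coeff (k + 3 - j) * (j : ℕ) +
        R.coeff (k + 3 - j)) * frobeniusSeq P Q R a₀ a₁ a₂ j) /
      -- With exponents `0` and `2` the indicial polynomial is `P₀ j (j - 2)`, taken here at `j = k
      -- + 3`.
      (P.coeff 0 * ((k + 3) * (k + 1)))
  decreasing_by exact j.2

/-- `h₁` is the equation at order one. At order two the indicial polynomial vanishes, so `a₂` is
free and `h₂` is the obstruction to avoiding a logarithm. From order three on the recursion is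
solvable. -/
theorem eulerOp_frobeniusSeq_eq_zero {P Q R : PowerSeries ℂ} (hP : P.coeff 0 ≠ 0)
    (hQ : Q.coeff 0 = -P.coeff 0) (hR : R.coeff 0 = 0) {a₀ a₁ a₂ : ℂ}
    (h₁ : R.coeff 1 * a₀ = P.coeff 0 * a₁)
    (h₂ : (Q.coeff 1 + R.coeff 1) * a₁ + R.coeff 2 * a₀ = 0) :
    eulerOp P Q R (PowerSeries.mk (frobeniusSeq P Q R a₀ a₁ a₂)) = 0 := by
  ext k
  rw [coeff_eulerOp, map_zero]
  rcases k with _ | _ | _ | k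
  · simp [hR]
  · simp only [Finset.sum_range_succ, Finset.sum_range_zero, PowerSeries.coeff_mk, frobeniusSeq]
    simp [hQ, hR, h₁]
  · simp only [Finset.sum_range_succ, Finset.sum_range_zero, PowerSeries.coeff_mk, frobeniusSeq]
    simp [hQ, hR]
    linear_combination h₂
  · have h3 : ((k : ℂ) + 3) ≠ 0 := by exact_mod_cast (k + 2).succ_ne_zero
    have h1 : ((k : ℂ) + 1) ≠ 0 := by exact_mod_cast k.succ_ne_zero
    rw [show k + 1 + 1 + 1 = k + 3 from rfl, Finset.sum_range_succ, PowerSeries.coeff_mk,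
      frobeniusSeq, ← Fin.sum_univ_eq_sum_range (fun j => (P.coeff (k + 3 - j) *
        ((j : ℂ) * (j - 1)) + Q.coeff (k + 3 - j) * j + R.coeff (k + 3 - j)) *
          (PowerSeries.mk (frobeniusSeq P Q R a₀ a₁ a₂)).coeff j)]
    simp only [PowerSeries.coeff_mk, Nat.sub_self, hQ, hR]
    push_cast
    field_simp
    ring

/-- A sequence with controlled linear recursion grows at most geometrically. -/
theorem exists_norm_le_mul_pow_of_recursion {u : ℕ → ℂ} {C r : ℝ} (hC : 0 < C) (hr : 0 < r)
    (h : ∀ k, 3 ≤ k → ‖u k‖ ≤ ∑ j ∈ Finset.range k, C * r ^ (k - j) * ‖u j‖) :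
    ∃ D K : ℝ, 0 < K ∧ ∀ k, ‖u k‖ ≤ D * K ^ k := by
  -- This ratio turns the recursive bound into a geometric sum equal to `D * K ^ k - D * r ^ k`; `D`
  -- is chosen to cover the first three terms.
  set K := r * (1 + C) with hKdef
  have hK : 0 < K := by positivity
  set D := ∑ j ∈ Finset.range 3, ‖u j‖ / K ^ j with hD
  have hD0 : 0 ≤ D := Finset.sum_nonneg fun j _ => by positivity
  refine ⟨D, K, hK, fun k => ?_⟩
  induction k using Nat.strong_induction_on with
  | _ k ih =>
    by_cases hk : 3 ≤ k
    · calc ‖u k‖ ≤ ∑ j ∈ Finset.range k, C * r ^ (k - j) * ‖u j‖ := h k hk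
        _ ≤ ∑ j ∈ Finset.range k, C * r ^ (k - j) * (D * K ^ j) := by
          gcongr with j hj
          exact ih j (Finset.mem_range.mp hj)
        _ = D * r ^ k * ((∑ j ∈ Finset.range k, (1 + C) ^ j) * ((1 + C) - 1)) := by
          rw [Finset.sum_mul (Finset.range k), Finset.mul_sum (Finset.range k)]
          refine Finset.sum_congr rfl fun j hj => ?_
          rw [← pow_sub_mul_pow r (Finset.mem_range.mp hj).le, hKdef, mul_pow]
          ring
        _ = D * K ^ k - D * r ^ k := by rw [geom_sum_mul, hKdef, mul_pow]; ring
        _ ≤ D * K ^ k := by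
          have : 0 ≤ D * r ^ k := by positivity
          linarith
    · have hle : ‖u k‖ / K ^ k ≤ D :=
        Finset.single_le_sum (f := fun j => ‖u j‖ / K ^ j) (fun j _ => by positivity)
          (Finset.mem_range.mpr (by omega))
      rwa [div_le_iff₀ (by positivity)] at hle

theorem exists_norm_frobeniusSeq_le {P Q R : PowerSeries ℂ} (hP : P.coeff 0 ≠ 0)
    {C r : ℝ} (hC : 0 < C) (hr : 0 < r) (hPb : ∀ k, ‖P.coeff k‖ ≤ C * r ^ k)
    (hQb : ∀ k, ‖Q.coeff k‖ ≤ C * r ^ k) (hRb : ∀ k, ‖R.coeff k‖ ≤ C * r ^ k) (a₀ a₁ a₂ : ℂ) :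
    ∃ D K : ℝ, 0 < K ∧ ∀ k, ‖frobeniusSeq P Q R a₀ a₁ a₂ k‖ ≤ D * K ^ k := by
  have hP' : 0 < ‖P.coeff 0‖ := norm_pos_iff.mpr hP
  refine exists_norm_le_mul_pow_of_recursion (C := 9 * C / ‖P.coeff 0‖) (by positivity) hr
    fun k hk => ?_
  obtain ⟨m, rfl⟩ := Nat.exists_eq_add_of_le' hk
  rw [frobeniusSeq, norm_div, norm_neg, div_le_iff₀ (by
    rw [norm_mul]
    refine mul_pos hP' (norm_pos_iff.mpr ?_)
    exact_mod_cast (by positivity : (m + 3) * (m + 1) ≠ 0)), Finset.sum_mul,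
    ← Fin.sum_univ_eq_sum_range (fun j => 9 * C / ‖P.coeff 0‖ * r ^ (m + 3 - j) *
      ‖frobeniusSeq P Q R a₀ a₁ a₂ j‖ * ‖P.coeff 0 * ((m + 3) * (m + 1))‖)]
  refine (norm_sum_le _ _).trans (Finset.sum_le_sum fun j _ => ?_)
  set s := m + 3 - (j : ℕ) with hs
  have hj : (j : ℝ) ≤ m + 2 := by exact_mod_cast Nat.lt_succ_iff.mp j.2
  have hn : ‖P.coeff 0 * (((m : ℂ) + 3) * (m + 1))‖ = ‖P.coeff 0‖ * ((m + 3) * (m + 1)) := by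
    rw [norm_mul]
    congr 1
    exact_mod_cast Complex.norm_natCast ((m + 3) * (m + 1))
  have hnj : ‖((j : ℕ) : ℂ)‖ = j := Complex.norm_natCast _
  have hnj1 : ‖((j : ℕ) : ℂ) - 1‖ ≤ j + 1 := by
    simpa [hnj] using norm_sub_le ((j : ℕ) : ℂ) 1
  have hj0 : (0 : ℝ) ≤ j := by positivity
  have hcoef : ‖P.coeff s * (((j : ℕ) : ℂ) * ((j : ℕ) - 1)) + Q.coeff s * (j : ℕ) + R.coeff s‖ ≤
      C * r ^ s * (j * (j + 1) + j + 1) := by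
    calc _ ≤ ‖P.coeff s‖ * (‖((j : ℕ) : ℂ)‖ * ‖((j : ℕ) : ℂ) - 1‖) +
          ‖Q.coeff s‖ * ‖((j : ℕ) : ℂ)‖ + ‖R.coeff s‖ := by
          refine (norm_add₃_le).trans ?_
          simp only [norm_mul, le_refl]
      _ ≤ C * r ^ s * (j * (j + 1)) + C * r ^ s * j + C * r ^ s := by
          rw [hnj]
          gcongr
          exacts [hPb s, hQb s, hRb s]
      _ = _ := by ring
  -- The left side is `(j + 1)² ≤ (m + 3)²`: the quadratic growth of the numerator is absorbed by
  -- the indicial polynomial in the denominator.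
  have hcomp : (j : ℝ) * (j + 1) + j + 1 ≤ 9 * ((m + 3) * (m + 1)) := by
    have hm : (0 : ℝ) ≤ m := by positivity
    nlinarith
  rw [norm_mul, hn]
  calc _ ≤ C * r ^ s * (9 * ((m + 3) * (m + 1))) * ‖frobeniusSeq P Q R a₀ a₁ a₂ j‖ := by
        refine mul_le_mul_of_nonneg_right (hcoef.trans ?_) (norm_nonneg _)
        gcongr
    _ = _ := by field_simp

/-! ### The local criterion for an apparent singularity -/

section Apparent

variable {c : ℂ} {Φ G H w : ℂ → ℂ}

/-- Multiplying by `((z - c) Φ)²`, nonzero on a punctured neighbourhood, gives an analytic function,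
which vanishes near `c` exactly when its Taylor series does. -/
theorem isRegularSolutionNear_iff_eulerOp (hΦ : AnalyticAt ℂ Φ c) (hΦ0 : Φ c ≠ 0)
    (hG : AnalyticAt ℂ G c) (hH : AnalyticAt ℂ H c) (hw : AnalyticAt ℂ w c) :
    IsRegularSolutionNear (fun z => G z / ((z - c) * Φ z)) (fun z => H z / ((z - c) * Φ z) ^ 2)
      c w ↔ eulerOp (taylorSeries c Φ ^ 2) (taylorSeries c Φ * taylorSeries c G)
        (taylorSeries c H) (taylorSeries c w) = 0 := by
  set s : ℂ → ℂ := fun z => z - c with hs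
  have hsa : AnalyticAt ℂ s c := by fun_prop
  set f : ℂ → ℂ := s ^ 2 * deriv (deriv w) * Φ ^ 2 + s * deriv w * (Φ * G) + w * H with hf
  have h1 : AnalyticAt ℂ (s ^ 2 * deriv (deriv w) * Φ ^ 2) c :=
    ((hsa.pow 2).mul hw.deriv.deriv).mul (hΦ.pow 2)
  have h2 : AnalyticAt ℂ (s * deriv w * (Φ * G)) c := (hsa.mul hw.deriv).mul (hΦ.mul hG)
  have h3 : AnalyticAt ℂ (w * H) c := hw.mul hH
  have hfa : AnalyticAt ℂ f c := (h1.add h2).add h3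
  have hT : taylorSeries c f = eulerOp (taylorSeries c Φ ^ 2)
      (taylorSeries c Φ * taylorSeries c G) (taylorSeries c H) (taylorSeries c w) := by
    rw [hf, taylorSeries_add (h1.add h2) h3, taylorSeries_add h1 h2,
      taylorSeries_mul ((hsa.pow 2).mul hw.deriv.deriv) (hΦ.pow 2),
      taylorSeries_mul (hsa.pow 2) hw.deriv.deriv, taylorSeries_mul (hsa.mul hw.deriv) (hΦ.mul hG),
      taylorSeries_mul hsa hw.deriv, taylorSeries_mul hΦ hG, taylorSeries_mul hw hH,
      taylorSeries_pow hsa 1, taylorSeries_pow hΦ 1, taylorSeries_deriv, taylorSeries_deriv,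
      taylorSeries_sub_const, eulerOp]
  have hΦne : ∀ᶠ z in 𝓝[≠] c, Φ z ≠ 0 :=
    (hΦ.continuousAt.eventually_ne hΦ0).filter_mono nhdsWithin_le_nhds
  have hequiv : (∀ᶠ z in 𝓝[≠] c, deriv (deriv w) z + G z / ((z - c) * Φ z) * deriv w z +
      H z / ((z - c) * Φ z) ^ 2 * w z = 0) ↔ ∀ᶠ z in 𝓝[≠] c, f z = 0 := by
    refine eventually_congr ?_
    filter_upwards [hΦne, self_mem_nhdsWithin] with z hz hzc
    have hzc' : z - c ≠ 0 := sub_ne_zero.mpr hzc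
    have hfz : f z = ((z - c) * Φ z) ^ 2 * (deriv (deriv w) z +
        G z / ((z - c) * Φ z) * deriv w z + H z / ((z - c) * Φ z) ^ 2 * w z) := by
      simp only [hf, hs, Pi.add_apply, Pi.mul_apply, Pi.pow_apply]
      field_simp
    rw [hfz, mul_eq_zero]
    simp [hzc', hz]
  rw [IsRegularSolutionNear, and_iff_right hw, hequiv, ← hT]
  constructor
  · intro h
    have h0 : ∀ᶠ z in 𝓝 c, f z = 0 := hfa.frequently_zero_iff_eventually_zero.mp h.frequently
    rw [taylorSeries_congr (g := fun _ => 0) h0]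
    ext k
    simp [coeff_taylorSeries]
  · intro h
    exact (eventually_eq_zero_of_taylorSeries_eq_zero hfa h).filter_mono nhdsWithin_le_nhds

/-- The formal Frobenius solution converges: the coefficients `Φ²`, `Φ G`, `H` have geometrically
bounded Taylor coefficients, and the sums of their constants give a common bound. -/
theorem exists_isRegularSolutionNear (hΦ : AnalyticAt ℂ Φ c) (hΦ0 : Φ c ≠ 0)
    (hG : AnalyticAt ℂ G c) (hH : AnalyticAt ℂ H c) (hG0 : G c = -Φ c) (hH0 : H c = 0)
    {a₀ a₁ a₂ : ℂ} (h₁ : (taylorSeries c H).coeff 1 * a₀ = Φ c ^ 2 * a₁)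
    (h₂ : ((taylorSeries c Φ * taylorSeries c G).coeff 1 + (taylorSeries c H).coeff 1) * a₁ +
      (taylorSeries c H).coeff 2 * a₀ = 0) :
    ∃ w, AnalyticAt ℂ w c ∧
      IsRegularSolutionNear (fun z => G z / ((z - c) * Φ z))
        (fun z => H z / ((z - c) * Φ z) ^ 2) c w ∧
      (taylorSeries c w).coeff 0 = a₀ ∧ (taylorSeries c w).coeff 1 = a₁ ∧
      (taylorSeries c w).coeff 2 = a₂ := by
  set P := taylorSeries c Φ ^ 2 with hP
  set Q := taylorSeries c Φ * taylorSeries c G with hQ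
  set R := taylorSeries c H with hR
  have e0 (f : ℂ → ℂ) : (taylorSeries c f).coeff 0 = f c := by simp [coeff_taylorSeries]
  have hP0 : P.coeff 0 = Φ c ^ 2 := by
    rw [hP, PowerSeries.coeff_zero_eq_constantCoeff_apply, map_pow,
      ← PowerSeries.coeff_zero_eq_constantCoeff_apply, e0]
  have hQ0 : Q.coeff 0 = -P.coeff 0 := by
    rw [hP0, hQ, PowerSeries.coeff_zero_eq_constantCoeff_apply, map_mul,
      ← PowerSeries.coeff_zero_eq_constantCoeff_apply,
      ← PowerSeries.coeff_zero_eq_constantCoeff_apply, e0, e0, hG0]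
    ring
  have hR0 : R.coeff 0 = 0 := by rw [hR, e0, hH0]
  have hPne : P.coeff 0 ≠ 0 := by rw [hP0]; exact pow_ne_zero 2 hΦ0
  have hPt : taylorSeries c (Φ ^ 2) = P := taylorSeries_pow hΦ 1
  have hQt : taylorSeries c (Φ * G) = Q := taylorSeries_mul hΦ hG
  obtain ⟨C₁, hC₁, r₁, hr₁, hb₁⟩ := exists_norm_coeff_taylorSeries_le (hΦ.pow 2)
  obtain ⟨C₂, hC₂, r₂, hr₂, hb₂⟩ := exists_norm_coeff_taylorSeries_le (hΦ.mul hG)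
  obtain ⟨C₃, hC₃, r₃, hr₃, hb₃⟩ := exists_norm_coeff_taylorSeries_le hH
  rw [hPt] at hb₁
  rw [hQt] at hb₂
  obtain ⟨D, K, hK, hu⟩ := exists_norm_frobeniusSeq_le (P := P) (Q := Q) (R := R) hPne
    (C := C₁ + C₂ + C₃) (r := r₁ + r₂ + r₃) (by positivity) (by positivity)
    (fun k => (hb₁ k).trans (by gcongr <;> linarith))
    (fun k => (hb₂ k).trans (by gcongr <;> linarith))
    (fun k => (hb₃ k).trans (by gcongr <;> linarith)) a₀ a₁ a₂
  obtain ⟨w, hw, hwT⟩ := exists_analyticAt_taylorSeries_eq c _ hK hu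
  refine ⟨w, hw, ?_, ?_, ?_, ?_⟩
  · rw [isRegularSolutionNear_iff_eulerOp hΦ hΦ0 hG hH hw, hwT]
    exact eulerOp_frobeniusSeq_eq_zero hPne hQ0 hR0 (by rw [hP0]; exact h₁) h₂
  all_goals simp [hwT, frobeniusSeq]

/-- The equation `w'' + G / ((z - c) Φ) w' + H / ((z - c) Φ)² w = 0` has an apparent singularity
of weight one at `c` if and only if its exponents there are `0` and `2`, and the obstruction to
the absence of logarithms vanishes. -/
theorem isApparentSingularity_iff (hΦ : AnalyticAt ℂ Φ c) (hΦ0 : Φ c ≠ 0)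
    (hG : AnalyticAt ℂ G c) (hH : AnalyticAt ℂ H c) :
    IsApparentSingularity (fun z => G z / ((z - c) * Φ z)) (fun z => H z / ((z - c) * Φ z) ^ 2)
      c ↔ G c = -Φ c ∧ H c = 0 ∧
        (Φ c * (deriv G c - deriv Φ c) + deriv H c) * (deriv H c / Φ c ^ 2) +
          deriv (deriv H) c / 2 = 0 := by
  have e0 (f : ℂ → ℂ) : (taylorSeries c f).coeff 0 = f c := by simp [coeff_taylorSeries]
  have e1 (f : ℂ → ℂ) : (taylorSeries c f).coeff 1 = deriv f c := by simp [coeff_taylorSeries]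
  have e2 (f : ℂ → ℂ) : (taylorSeries c f).coeff 2 = deriv (deriv f) c / 2 := by
    simp [coeff_taylorSeries, iteratedDeriv_succ']
  have hP0 : (taylorSeries c Φ ^ 2).coeff 0 = Φ c ^ 2 := by
    rw [PowerSeries.coeff_zero_eq_constantCoeff_apply, map_pow,
      ← PowerSeries.coeff_zero_eq_constantCoeff_apply, e0]
  have hQ0 : (taylorSeries c Φ * taylorSeries c G).coeff 0 = Φ c * G c := by
    rw [PowerSeries.coeff_zero_eq_constantCoeff_apply, map_mul,
      ← PowerSeries.coeff_zero_eq_constantCoeff_apply,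
      ← PowerSeries.coeff_zero_eq_constantCoeff_apply, e0, e0]
  have hQ1 : (taylorSeries c Φ * taylorSeries c G).coeff 1 = Φ c * deriv G c + deriv Φ c * G c := by
    rw [PowerSeries.coeff_mul, Finset.Nat.sum_antidiagonal_eq_sum_range_succ_mk]
    simp [Finset.sum_range_succ, e0, e1]
  constructor
  · rintro ⟨w₁, w₂, h, hw₁, hw₁0, hw₂, hh, hh0, hwh⟩
    have E1 := (isRegularSolutionNear_iff_eulerOp hΦ hΦ0 hG hH hw₁.1).mp hw₁
    have E2 := (isRegularSolutionNear_iff_eulerOp hΦ hΦ0 hG hH hw₂.1).mp hw₂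
    have hT2 := taylorSeries_eq_X_sq_mul hh hwh
    have c0 : (taylorSeries c w₂).coeff 0 = 0 := by
      simp [hT2, PowerSeries.coeff_X_pow_mul']
    have c1 : (taylorSeries c w₂).coeff 1 = 0 := by
      simp [hT2, PowerSeries.coeff_X_pow_mul']
    have c2 : (taylorSeries c w₂).coeff 2 = h c := by
      rw [hT2, PowerSeries.coeff_X_pow_mul']
      simp [e0]
    have E10 := congrArg (PowerSeries.coeff 0) E1
    have E11 := congrArg (PowerSeries.coeff 1) E1
    have E12 := congrArg (PowerSeries.coeff 2) E1
    have E22 := congrArg (PowerSeries.coeff 2) E2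
    simp only [coeff_eulerOp, map_zero, Finset.sum_range_succ, Finset.sum_range_zero,
      Nat.sub_zero, Nat.sub_self, Nat.reduceSub, hP0, hQ0, hQ1, e0, e1 H, e2 H, c1, c2]
      at E10 E11 E12 E22
    push_cast at E10 E11 E12 E22
    -- Order zero for `w₁`: `0` is an exponent.
    have hH0 : H c = 0 := by
      have : H c * w₁ c = 0 := by linear_combination E10
      exact (mul_eq_zero.mp this).resolve_right hw₁0
    rw [hH0] at E11 E12 E22
    rw [e0] at c0
    rw [c0] at E22
    -- Order two for `w₂`: the indicial polynomial vanishes at `2`.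
    have hG0 : G c = -Φ c := by
      have : (2 * Φ c * h c) * (Φ c + G c) = 0 := by linear_combination E22
      have hne : 2 * Φ c * h c ≠ 0 := by simp [hΦ0, hh0]
      linear_combination (mul_eq_zero.mp this).resolve_left hne
    refine ⟨hG0, hH0, ?_⟩
    rw [hG0] at E11 E12
    -- Order one determines `u`; at order two the second coefficient of `w₁` drops out, since `2` is
    -- an exponent, and the obstruction remains.
    set u := (taylorSeries c w₁).coeff 1
    have hu : u = deriv H c * w₁ c / Φ c ^ 2 := by
      rw [eq_div_iff (pow_ne_zero 2 hΦ0)]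
      linear_combination -E11
    rw [hu] at E12
    refine (mul_eq_zero.mp (?_ : w₁ c * _ = 0)).resolve_left hw₁0
    rw [← E12]
    ring
  · rintro ⟨hG0, hH0, hlog⟩
    -- The value of `a₁` is forced by order one, whereas `a₂` is arbitrary.
    obtain ⟨w₁, hw₁, hs₁, h10, -, -⟩ := exists_isRegularSolutionNear (a₀ := 1)
      (a₁ := deriv H c / Φ c ^ 2) (a₂ := 0) hΦ hΦ0 hG hH hG0 hH0
      (by rw [e1]; field_simp)
      (by rw [hQ1, e1, e2, hG0]; linear_combination hlog)
    obtain ⟨w₂, hw₂, hs₂, h20, h21, h22⟩ := exists_isRegularSolutionNear (a₀ := 0)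
      (a₁ := 0) (a₂ := 1) hΦ hΦ0 hG hH hG0 hH0 (by simp) (by simp)
    rw [e0] at h10 h20
    rw [e1] at h21
    rw [e2] at h22
    obtain ⟨h, hh, hwh⟩ := (natCast_le_analyticOrderAt hw₂ (n := 2)).mp
      ((natCast_le_analyticOrderAt_iff_iteratedDeriv_eq_zero hw₂).mpr fun i hi => by
        interval_cases i <;> simp [h20, h21])
    refine ⟨w₁, w₂, h, hs₁, by simp [h10], hs₂, hh, ?_, by simpa using hwh⟩
    intro hh0
    have hT2 := taylorSeries_eq_X_sq_mul hh (by simpa using hwh)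
    have := congrArg (PowerSeries.coeff 2) hT2
    rw [e2, h22, PowerSeries.coeff_X_pow_mul'] at this
    simp [e0, hh0] at this

end Apparent

/-! ### Exponents and momenta as conditions on the coefficients -/

section LocalLimits

variable {c : ℂ} {Φ G H : ℂ → ℂ}

theorem hasExponentsAt_iff_of_tendsto {a b : ℂ → ℂ} {g h ρ₁ ρ₂ : ℂ}
    (ha : Tendsto (fun z => (z - c) * a z) (𝓝[≠] c) (𝓝 g))
    (hb : Tendsto (fun z => (z - c) ^ 2 * b z) (𝓝[≠] c) (𝓝 h)) :
    HasExponentsAt a b c ρ₁ ρ₂ ↔ g = 1 - ρ₁ - ρ₂ ∧ h = ρ₁ * ρ₂ := by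
  constructor
  · rintro ⟨g', h', hg', hh', hρ⟩
    obtain rfl := tendsto_nhds_unique ha hg'
    obtain rfl := tendsto_nhds_unique hb hh'
    have h0 := hρ 0
    have h1 := hρ 1
    exact ⟨by linear_combination h1 - h0, by linear_combination h0⟩
  · rintro ⟨rfl, rfl⟩
    exact ⟨_, _, ha, hb, fun ρ => by ring⟩

theorem hasExponentsAt_iff (hΦ : ContinuousAt Φ c) (hΦ0 : Φ c ≠ 0) (hG : ContinuousAt G c)
    (hH : ContinuousAt H c) (ρ₁ ρ₂ : ℂ) :
    HasExponentsAt (fun z => G z / ((z - c) * Φ z)) (fun z => H z / ((z - c) * Φ z) ^ 2) c ρ₁ ρ₂ ↔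
      G c = (1 - ρ₁ - ρ₂) * Φ c ∧ H c = ρ₁ * ρ₂ * Φ c ^ 2 := by
  have ha : Tendsto (fun z => (z - c) * (G z / ((z - c) * Φ z))) (𝓝[≠] c) (𝓝 (G c / Φ c)) := by
    have h : Tendsto (fun z => G z / Φ z) (𝓝[≠] c) (𝓝 (G c / Φ c)) :=
      (hG.div hΦ hΦ0).tendsto.mono_left nhdsWithin_le_nhds
    refine h.congr' ?_
    filter_upwards [self_mem_nhdsWithin] with z hz
    have hz' : z - c ≠ 0 := sub_ne_zero.mpr hz
    rw [← mul_div_assoc, mul_div_mul_left _ _ hz']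
  have hb : Tendsto (fun z => (z - c) ^ 2 * (H z / ((z - c) * Φ z) ^ 2)) (𝓝[≠] c)
      (𝓝 (H c / Φ c ^ 2)) := by
    have h : Tendsto (fun z => H z / Φ z ^ 2) (𝓝[≠] c) (𝓝 (H c / Φ c ^ 2)) :=
      (hH.div (hΦ.pow 2) (pow_ne_zero 2 hΦ0)).tendsto.mono_left nhdsWithin_le_nhds
    refine h.congr' ?_
    filter_upwards [self_mem_nhdsWithin] with z hz
    have hz' : z - c ≠ 0 := sub_ne_zero.mpr hz
    rw [← mul_div_assoc, mul_pow, mul_div_mul_left _ _ (pow_ne_zero 2 hz')]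
  rw [hasExponentsAt_iff_of_tendsto ha hb, div_eq_iff hΦ0, div_eq_iff (pow_ne_zero 2 hΦ0)]

theorem tendsto_momentum (hΦ : ContinuousAt Φ c) (hΦ0 : Φ c ≠ 0) (hH : DifferentiableAt ℂ H c)
    (hH0 : H c = 0) :
    Tendsto (fun z => (z - c) * (H z / ((z - c) * Φ z) ^ 2)) (𝓝[≠] c)
      (𝓝 (deriv H c / Φ c ^ 2)) := by
  have h : Tendsto (fun z => slope H c z / Φ z ^ 2) (𝓝[≠] c) (𝓝 (deriv H c / Φ c ^ 2)) :=
    (hasDerivAt_iff_tendsto_slope.mp hH.hasDerivAt).div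
      ((hΦ.pow 2).tendsto.mono_left nhdsWithin_le_nhds) (pow_ne_zero 2 hΦ0)
  refine h.congr' ?_
  filter_upwards [self_mem_nhdsWithin] with z hz
  have hz' : z - c ≠ 0 := sub_ne_zero.mpr hz
  rw [slope_def_field, hH0, sub_zero]
  -- At a zero of `Φ` both sides are `0` by the convention for division.
  by_cases hΦz : Φ z = 0
  · simp [hΦz]
  · field_simp

end LocalLimits

/-! ### Polynomials given by their coefficients -/

section OfCoeffs

open Polynomial

/-- The polynomial with coefficients `v 0, …, v (K - 1)`. -/
def ofCoeffs (K : ℕ) : (Fin K → ℂ) →ₗ[ℂ] ℂ[X] :=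
  (degreeLT ℂ K).subtype ∘ₗ (degreeLTEquiv ℂ K).symm.toLinearMap

variable {K : ℕ}

theorem ofCoeffs_eq_sum (v : Fin K → ℂ) : ofCoeffs K v = ∑ i : Fin K, monomial i (v i) := rfl

theorem degree_ofCoeffs_lt (v : Fin K → ℂ) : (ofCoeffs K v).degree < K :=
  mem_degreeLT.mp ((degreeLTEquiv ℂ K).symm v).2

theorem coeff_ofCoeffs (v : Fin K → ℂ) (i : Fin K) : (ofCoeffs K v).coeff i = v i :=
  congrFun ((degreeLTEquiv ℂ K).apply_symm_apply v) i

theorem ofCoeffs_coeff {p : ℂ[X]} (hp : p.degree < K) : ofCoeffs K (fun i => p.coeff i) = p :=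
  congrArg Subtype.val ((degreeLTEquiv ℂ K).symm_apply_apply ⟨p, mem_degreeLT.mpr hp⟩)

theorem ofCoeffs_injective : Function.Injective (ofCoeffs K) :=
  Subtype.val_injective.comp (degreeLTEquiv ℂ K).symm.injective

theorem ofCoeffs_eq_iff {p : ℂ[X]} (hp : p.degree < K) (v : Fin K → ℂ) :
    ofCoeffs K v = p ↔ ∀ i, v i = p.coeff i := by
  rw [← ofCoeffs_coeff hp, ofCoeffs_injective.eq_iff, funext_iff, ofCoeffs_coeff hp]

theorem eval_ofCoeffs (v : Fin K → ℂ) (z : ℂ) :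
    (ofCoeffs K v).eval z = ∑ i, v i * z ^ (i : ℕ) := by
  simp [ofCoeffs_eq_sum, eval_finsetSum]

theorem eval_derivative_ofCoeffs (v : Fin K → ℂ) (z : ℂ) :
    (derivative (ofCoeffs K v)).eval z = ∑ i : Fin K, ((i : ℕ) : ℂ) * z ^ ((i : ℕ) - 1) * v i := by
  simp only [ofCoeffs_eq_sum, derivative_sum, derivative_monomial, eval_finsetSum, eval_monomial]
  exact Finset.sum_congr rfl fun i _ => by ring

theorem eval_derivative_derivative_ofCoeffs (v : Fin K → ℂ) (z : ℂ) :
    (derivative (derivative (ofCoeffs K v))).eval z =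
      ∑ i : Fin K, ((i : ℕ) : ℂ) * (((i : ℕ) : ℂ) - 1) * z ^ ((i : ℕ) - 2) * v i := by
  simp only [ofCoeffs_eq_sum, derivative_sum, derivative_monomial, eval_finsetSum, eval_monomial]
  refine Finset.sum_congr rfl fun i _ => ?_
  rcases hi : (i : ℕ) with _ | m
  · simp
  · rw [show m + 1 - 2 = m + 1 - 1 - 1 by omega, Nat.add_sub_cancel]
    push_cast
    ring

/-- The reversed polynomial, with coefficients `v (K - 1), …, v 0`, evaluated at `z`. -/
def evalReversed (v : Fin K → ℂ) (z : ℂ) : ℂ := ∑ i : Fin K, v i * z ^ (K - 1 - (i : ℕ))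

theorem continuous_evalReversed (v : Fin K → ℂ) : Continuous (evalReversed v) := by
  unfold evalReversed
  fun_prop

theorem evalReversed_zero (v : Fin K → ℂ) (hK : 0 < K) :
    evalReversed v 0 = (ofCoeffs K v).coeff (K - 1) := by
  have h := coeff_ofCoeffs v ⟨K - 1, by omega⟩
  simp only at h
  rw [h, evalReversed, Finset.sum_eq_single ⟨K - 1, by omega⟩]
  · simp
  · intro i _ hi
    have hne : K - 1 - (i : ℕ) ≠ 0 := by
      intro h0
      apply hi
      ext
      simp only
      omega
    simp [hne]
  · simp

theorem eval_inv_ofCoeffs (v : Fin K → ℂ) {u : ℂ} (hu : u ≠ 0) :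
    u ^ (K - 1) * (ofCoeffs K v).eval u⁻¹ = evalReversed v u := by
  rw [eval_ofCoeffs, Finset.mul_sum, evalReversed]
  refine Finset.sum_congr rfl fun i _ => ?_
  rw [← pow_sub_mul_pow u (show (i : ℕ) ≤ K - 1 by omega), inv_pow]
  field_simp

end OfCoeffs

/-! ### The equations in terms of polynomials -/

section Equations

open Polynomial

variable {n N : ℕ} (t : Fin n → ℂ) (q : Fin N → ℂ)

/-- All finite singular points. -/
def nodes : Fin n ⊕ Fin N → ℂ := Sum.elim t q

/-- The product of `X - C s` over all finite singular points `s` other than the given one. -/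
def cofactor (a : Fin n ⊕ Fin N) : ℂ[X] := Lagrange.nodal (Finset.univ.erase a) (nodes t q)

variable {t q}

theorem nodes_injective (ht : Function.Injective t) (hq : Function.Injective q)
    (htq : ∀ i j, t i ≠ q j) : Function.Injective (nodes t q) :=
  ht.sumElim hq htq

theorem psi_eq_mul_cofactor (a : Fin n ⊕ Fin N) (z : ℂ) :
    psi t q z = (z - nodes t q a) * (cofactor t q a).eval z := by
  rw [cofactor, Lagrange.eval_nodal, Finset.mul_prod_erase _ (fun b => z - nodes t q b)
    (Finset.mem_univ a), Fintype.prod_sum_type]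
  rfl

theorem eval_cofactor_ne_zero (hs : Function.Injective (nodes t q)) (a : Fin n ⊕ Fin N) :
    (cofactor t q a).eval (nodes t q a) ≠ 0 := by
  rw [cofactor, Lagrange.eval_nodal, Finset.prod_ne_zero_iff]
  intro b hb
  exact sub_ne_zero.mpr fun h => (Finset.ne_of_mem_erase hb) (hs h).symm

theorem mu_eq (j : Fin N) : mu t q j = 1 / (cofactor t q (.inr j)).eval (q j) ^ 2 := by
  have huniv : (Finset.univ : Finset (Fin n ⊕ Fin N)).erase (.inr j) =
      Finset.univ.disjSum (Finset.univ.erase j) := by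
    ext (i | k) <;> simp
  rw [cofactor, Lagrange.eval_nodal, huniv, Finset.prod_disjSum, mu, mul_pow, Finset.prod_pow,
    Finset.prod_pow]
  rfl

variable (x : CoeffSpace n N)

/-- The polynomial `G`. -/
def polyG : ℂ[X] := ofCoeffs (n + N) fun m => x (.inl m)

/-- The polynomial `H`. -/
def polyH : ℂ[X] := ofCoeffs (2 * (n + N) - 1) fun m => x (.inr m)

theorem coeffA_eq (a : Fin n ⊕ Fin N) :
    coeffA t q x = fun z => (polyG x).eval z / ((z - nodes t q a) * (cofactor t q a).eval z) := by
  ext z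
  rw [coeffA, psi_eq_mul_cofactor a, polyG, eval_ofCoeffs]
  rfl

theorem coeffB_eq (a : Fin n ⊕ Fin N) :
    coeffB t q x =
      fun z => (polyH x).eval z / ((z - nodes t q a) * (cofactor t q a).eval z) ^ 2 := by
  ext z
  rw [coeffB, psi_eq_mul_cofactor a, polyH, eval_ofCoeffs]
  rfl

variable {x}

theorem hasExponentsAt_node_iff (hs : Function.Injective (nodes t q)) (a : Fin n ⊕ Fin N)
    (ρ₁ ρ₂ : ℂ) :
    HasExponentsAt (coeffA t q x) (coeffB t q x) (nodes t q a) ρ₁ ρ₂ ↔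
      (polyG x).eval (nodes t q a) = (1 - ρ₁ - ρ₂) * (cofactor t q a).eval (nodes t q a) ∧
      (polyH x).eval (nodes t q a) = ρ₁ * ρ₂ * (cofactor t q a).eval (nodes t q a) ^ 2 := by
  rw [coeffA_eq x a, coeffB_eq x a]
  exact hasExponentsAt_iff (cofactor t q a).continuous.continuousAt (eval_cofactor_ne_zero hs a)
    (polyG x).continuous.continuousAt (polyH x).continuous.continuousAt ρ₁ ρ₂

theorem isApparentSingularity_node_iff (hs : Function.Injective (nodes t q)) (a : Fin n ⊕ Fin N) :
    IsApparentSingularity (coeffA t q x) (coeffB t q x) (nodes t q a) ↔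
      (polyG x).eval (nodes t q a) = -(cofactor t q a).eval (nodes t q a) ∧
      (polyH x).eval (nodes t q a) = 0 ∧
      ((cofactor t q a).eval (nodes t q a) * ((derivative (polyG x)).eval (nodes t q a) -
        (derivative (cofactor t q a)).eval (nodes t q a)) +
          (derivative (polyH x)).eval (nodes t q a)) *
        ((derivative (polyH x)).eval (nodes t q a) / (cofactor t q a).eval (nodes t q a) ^ 2) +
        (derivative (derivative (polyH x))).eval (nodes t q a) / 2 = 0 := by
  have han (p : ℂ[X]) (c : ℂ) : AnalyticAt ℂ (fun z => p.eval z) c :=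
    (p.differentiable.analyticAt c)
  have hd (p : ℂ[X]) : deriv (fun z => p.eval z) = fun z => (derivative p).eval z :=
    funext fun z => p.deriv
  rw [coeffA_eq x a, coeffB_eq x a, isApparentSingularity_iff (han _ _)
    (eval_cofactor_ne_zero hs a) (han _ _) (han _ _)]
  simp only [hd]

theorem tendsto_momentum_node (hs : Function.Injective (nodes t q)) (a : Fin n ⊕ Fin N)
    (hH : (polyH x).eval (nodes t q a) = 0) :
    Tendsto (fun z => (z - nodes t q a) * coeffB t q x z) (𝓝[≠] (nodes t q a))
      (𝓝 ((derivative (polyH x)).eval (nodes t q a) /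
        (cofactor t q a).eval (nodes t q a) ^ 2)) := by
  rw [coeffB_eq x a, ← (polyH x).deriv]
  exact tendsto_momentum (cofactor t q a).continuous.continuousAt (eval_cofactor_ne_zero hs a)
    (polyH x).differentiableAt hH

/-- Under `z = 1 / u` the powers of `u` cancel and leave reversed polynomials over powers of `∏ (1 -
u s)`, `s` running over the nodes. At `u = 0` these give the top coefficients, and the coefficient
of the indicial equation is `2 - G_{n+N-1}`. -/
theorem hasExponentsAtInfty_iff (hM : 0 < n + N) (ρ₁ ρ₂ : ℂ) :
    HasExponentsAtInfty (coeffA t q x) (coeffB t q x) ρ₁ ρ₂ ↔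
      (polyG x).coeff (n + N - 1) = 1 + ρ₁ + ρ₂ ∧
      (polyH x).coeff (2 * (n + N - 1)) = ρ₁ * ρ₂ := by
  set ψ : ℂ → ℂ := fun u => ∏ a, (1 - u * nodes t q a) with hψ
  have hψc : Continuous ψ := by
    rw [hψ]
    fun_prop
  have hψ0 : ψ 0 = 1 := by simp [hψ]
  have hψeq (u : ℂ) (hu : u ≠ 0) : u ^ (n + N) * psi t q u⁻¹ = ψ u := by
    have hpsi : psi t q u⁻¹ = ∏ a, (u⁻¹ - nodes t q a) := by
      rw [Fintype.prod_sum_type]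
      rfl
    have hc : u ^ (n + N) = ∏ _a : Fin n ⊕ Fin N, u := by simp
    rw [hpsi, hc, ← Finset.prod_mul_distrib]
    exact Finset.prod_congr rfl fun a _ => by rw [mul_sub, mul_inv_cancel₀ hu]
  have hA (u : ℂ) (hu : u ≠ 0) : coeffA t q x u⁻¹ =
      u * (evalReversed (fun m => x (.inl m)) u / ψ u) := by
    have hG : evalG x u⁻¹ = (ofCoeffs (n + N) fun m => x (.inl m)).eval u⁻¹ :=
      (eval_ofCoeffs _ _).symm
    have hpow : u ^ (n + N) = u ^ (n + N - 1) * u := by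
      rw [← pow_succ, Nat.sub_add_cancel hM]
    have h0 := pow_ne_zero (n + N - 1) hu
    rw [← hψeq u hu, ← eval_inv_ofCoeffs _ hu, coeffA, hG, hpow]
    field_simp
  have hB (u : ℂ) (hu : u ≠ 0) : coeffB t q x u⁻¹ =
      u ^ 2 * (evalReversed (fun m => x (.inr m)) u / ψ u ^ 2) := by
    have hH : evalH x u⁻¹ = (ofCoeffs (2 * (n + N) - 1) fun m => x (.inr m)).eval u⁻¹ :=
      (eval_ofCoeffs _ _).symm
    have hpow : (u ^ (n + N)) ^ 2 = u ^ (2 * (n + N) - 1 - 1) * u ^ 2 := by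
      rw [← pow_add, ← pow_mul]
      congr 1
      omega
    have h0 := pow_ne_zero (2 * (n + N) - 1 - 1) hu
    rw [← hψeq u hu, ← eval_inv_ofCoeffs _ hu, coeffB, hH, mul_pow, hpow]
    field_simp
  have ha : Tendsto (fun u => (u - 0) * (2 / u - coeffA t q x u⁻¹ / u ^ 2)) (𝓝[≠] 0)
      (𝓝 (2 - (polyG x).coeff (n + N - 1))) := by
    have h : Tendsto (fun u => 2 - evalReversed (fun m => x (.inl m)) u / ψ u) (𝓝[≠] 0)
        (𝓝 (2 - evalReversed (fun m => x (.inl m)) 0 / ψ 0)) :=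
      (continuousAt_const.sub ((continuous_evalReversed _).continuousAt.div hψc.continuousAt
        (by simp [hψ0]))).tendsto.mono_left nhdsWithin_le_nhds
    rw [evalReversed_zero _ hM, hψ0, div_one] at h
    refine h.congr' ?_
    filter_upwards [self_mem_nhdsWithin] with u hu
    have hu' : u ≠ 0 := hu
    rw [hA u hu']
    field_simp
    ring
  have hb : Tendsto (fun u => (u - 0) ^ 2 * (coeffB t q x u⁻¹ / u ^ 4)) (𝓝[≠] 0)
      (𝓝 ((polyH x).coeff (2 * (n + N - 1)))) := by
    have h : Tendsto (fun u => evalReversed (fun m => x (.inr m)) u / ψ u ^ 2) (𝓝[≠] 0)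
        (𝓝 (evalReversed (fun m => x (.inr m)) 0 / ψ 0 ^ 2)) :=
      ((continuous_evalReversed _).continuousAt.div (hψc.pow 2).continuousAt
        (by simp [hψ0])).tendsto.mono_left nhdsWithin_le_nhds
    rw [evalReversed_zero _ (by omega), hψ0, one_pow, div_one,
      show 2 * (n + N) - 1 - 1 = 2 * (n + N - 1) by omega] at h
    refine h.congr' ?_
    filter_upwards [self_mem_nhdsWithin] with u hu
    have hu' : u ≠ 0 := hu
    rw [hB u hu']
    field_simp
    ring
  rw [HasExponentsAtInfty, hasExponentsAt_iff_of_tendsto ha hb]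
  refine and_congr_left fun _ => ⟨fun h => ?_, fun h => ?_⟩
  · linear_combination -h
  · linear_combination -h

end Equations

/-! ### ### The conditions on the coefficients as a linear system -/

section LinearSystem

open Polynomial

variable {n N : ℕ} (t : Fin n → ℂ) (q : Fin N → ℂ)

theorem systemMatrix_mulVec_inl (v : Fin (2 * (n + N) - 1) → ℂ) (hM : 0 < n + N) (i : Unit) :
    (systemMatrix t q).mulVec v (.inl i) =
      (ofCoeffs (2 * (n + N) - 1) v).coeff (2 * (n + N - 1)) := by
  have h := coeff_ofCoeffs v ⟨2 * (n + N - 1), by omega⟩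
  simp only at h
  rw [h, Matrix.mulVec, dotProduct, Finset.sum_eq_single ⟨2 * (n + N - 1), by omega⟩]
  · simp [systemMatrix]
  · intro m _ hm
    have : (m : ℕ) ≠ 2 * (n + N - 1) := fun h => hm (Fin.ext h)
    simp [systemMatrix, this]
  · simp

theorem systemMatrix_mulVec_t (v : Fin (2 * (n + N) - 1) → ℂ) (i : Fin n) :
    (systemMatrix t q).mulVec v (.inr (.inl i)) =
      (ofCoeffs (2 * (n + N) - 1) v).eval (t i) := by
  rw [eval_ofCoeffs, Matrix.mulVec, dotProduct]
  exact Finset.sum_congr rfl fun m _ => mul_comm _ _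

theorem systemMatrix_mulVec_q (v : Fin (2 * (n + N) - 1) → ℂ) (j : Fin N) :
    (systemMatrix t q).mulVec v (.inr (.inr (.inl j))) =
      (ofCoeffs (2 * (n + N) - 1) v).eval (q j) := by
  rw [eval_ofCoeffs, Matrix.mulVec, dotProduct]
  exact Finset.sum_congr rfl fun m _ => mul_comm _ _

theorem systemMatrix_mulVec_q' (v : Fin (2 * (n + N) - 1) → ℂ) (j : Fin N) :
    (systemMatrix t q).mulVec v (.inr (.inr (.inr (.inl j)))) =
      (derivative (ofCoeffs (2 * (n + N) - 1) v)).eval (q j) := by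
  rw [eval_derivative_ofCoeffs]
  rfl

theorem systemMatrix_mulVec_q'' (v : Fin (2 * (n + N) - 1) → ℂ) (j : Fin N) :
    (systemMatrix t q).mulVec v (.inr (.inr (.inr (.inr j)))) =
      (derivative (derivative (ofCoeffs (2 * (n + N) - 1) v))).eval (q j) := by
  rw [eval_derivative_derivative_ofCoeffs]
  rfl

/-- The residues of `G / ψ` prescribed by the exponents. -/
def residue (ρ₁ ρ₂ : Fin (n + 1) → ℂ) : Fin n ⊕ Fin N → ℂ :=
  Sum.elim (fun i => 1 - ρ₁ i.succ - ρ₂ i.succ) fun _ => -1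

/-- The polynomial `G` determined by the exponents. -/
def fixedG (ρ₁ ρ₂ : Fin (n + 1) → ℂ) : ℂ[X] :=
  Lagrange.interpolate Finset.univ (nodes t q) fun a =>
    residue ρ₁ ρ₂ a * (cofactor t q a).eval (nodes t q a)

/-- The value `β_i` of `H` at `t_i` prescribed by the exponents. -/
def betaCoeff (ρ₁ ρ₂ : Fin (n + 1) → ℂ) (i : Fin n) : ℂ :=
  ρ₁ i.succ * ρ₂ i.succ * (cofactor t q (.inl i)).eval (t i) ^ 2

/-- The coefficient `δ_j` of `p_j²` in `H''(q_j)`. -/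
def deltaCoeff (j : Fin N) : ℂ := -2 * (cofactor t q (.inr j)).eval (q j) ^ 2

/-- The coefficient `ε_j` of `p_j` in `H''(q_j)`. -/
def epsCoeff (ρ₁ ρ₂ : Fin (n + 1) → ℂ) (j : Fin N) : ℂ :=
  -2 * (cofactor t q (.inr j)).eval (q j) * ((derivative (fixedG t q ρ₁ ρ₂)).eval (q j) -
    (derivative (cofactor t q (.inr j))).eval (q j))

variable {t q} {ρ₁ ρ₂ : Fin (n + 1) → ℂ}

theorem degree_fixedG_lt (hs : Function.Injective (nodes t q)) :
    (fixedG t q ρ₁ ρ₂).degree < (n + N : ℕ) := by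
  have h := Lagrange.degree_interpolate_lt (s := Finset.univ) (v := nodes t q)
    (fun a => residue ρ₁ ρ₂ a * (cofactor t q a).eval (nodes t q a)) hs.injOn
  rw [Finset.card_univ, Fintype.card_sum, Fintype.card_fin, Fintype.card_fin] at h
  exact h

theorem eval_fixedG (hs : Function.Injective (nodes t q)) (a : Fin n ⊕ Fin N) :
    (fixedG t q ρ₁ ρ₂).eval (nodes t q a) =
      residue ρ₁ ρ₂ a * (cofactor t q a).eval (nodes t q a) :=
  Lagrange.eval_interpolate_at_node _ hs.injOn (Finset.mem_univ a)

/-- The top coefficient of a Lagrange interpolant is the sum of its values divided by the products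
of node differences, here the sum of the residues of `G / ψ`. -/
theorem coeff_fixedG (hs : Function.Injective (nodes t q))
    (hFuchs : ∑ i, (ρ₁ i + ρ₂ i) = (n : ℂ) - 1 - (N : ℂ)) :
    (fixedG t q ρ₁ ρ₂).coeff (n + N - 1) = 1 + ρ₁ 0 + ρ₂ 0 := by
  have h := Lagrange.coeff_eq_sum (s := Finset.univ) (v := nodes t q) hs.injOn
    (P := fixedG t q ρ₁ ρ₂) (by simpa using degree_fixedG_lt hs)
  have hterm (a : Fin n ⊕ Fin N) : (fixedG t q ρ₁ ρ₂).eval (nodes t q a) /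
      ∏ b ∈ Finset.univ.erase a, (nodes t q a - nodes t q b) = residue ρ₁ ρ₂ a := by
    rw [← Lagrange.eval_nodal, ← cofactor, eval_fixedG hs,
      mul_div_cancel_right₀ _ (eval_cofactor_ne_zero hs a)]
  simp only [hterm, Finset.card_univ, Fintype.card_sum, Fintype.card_fin, Fintype.sum_sum_type,
    residue, Sum.elim_inl, Sum.elim_inr] at h
  rw [h]
  rw [Fin.sum_univ_succ] at hFuchs
  simp only [sub_sub, Finset.sum_sub_distrib, Finset.sum_const, Finset.card_univ,
    Fintype.card_fin, nsmul_eq_mul]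
  linear_combination -hFuchs

theorem polyG_eq_fixedG_iff (hs : Function.Injective (nodes t q)) (x : CoeffSpace n N) :
    polyG x = fixedG t q ρ₁ ρ₂ ↔ ∀ a, (polyG x).eval (nodes t q a) =
      residue ρ₁ ρ₂ a * (cofactor t q a).eval (nodes t q a) := by
  constructor
  · intro h a
    rw [h, eval_fixedG hs]
  · intro h
    refine Lagrange.eq_interpolate_of_eval_eq _ hs.injOn ?_ fun a _ => h a
    rw [Finset.card_univ, Fintype.card_sum, Fintype.card_fin, Fintype.card_fin]
    exact degree_ofCoeffs_lt _

theorem exists_hasMomenta (hs : Function.Injective (nodes t q)) {x : CoeffSpace n N}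
    (hx : x ∈ equationSpace t q ρ₁ ρ₂) :
    ∃ p, HasMomenta t q x p :=
  ⟨_, fun j => tendsto_momentum_node hs (.inr j)
    ((isApparentSingularity_node_iff hs (.inr j)).mp (hx.2.2 j)).2.1⟩

/-- The conditions on `G` amount to interpolation at the nodes. For `H`, the momentum is `p_j = μ_j
H'(q_j)`, and inserting this makes the obstruction at `q_j` a formula for `H''(q_j)`. -/
theorem mem_equationsWithMomenta_iff (hs : Function.Injective (nodes t q)) (hM : 0 < n + N)
    (hFuchs : ∑ i, (ρ₁ i + ρ₂ i) = (n : ℂ) - 1 - (N : ℂ)) (p : Fin N → ℂ) (x : CoeffSpace n N) :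
    x ∈ equationsWithMomenta t q ρ₁ ρ₂ p ↔
      (∀ m : Fin (n + N), x (.inl m) = (fixedG t q ρ₁ ρ₂).coeff m) ∧
      (systemMatrix t q).mulVec (fun m => x (.inr m)) =
        systemRhs t q (ρ₁ 0 * ρ₂ 0) (betaCoeff t q ρ₁ ρ₂) (deltaCoeff t q)
          (epsCoeff t q ρ₁ ρ₂) p := by
  have hG : (∀ m : Fin (n + N), x (.inl m) = (fixedG t q ρ₁ ρ₂).coeff m) ↔
      polyG x = fixedG t q ρ₁ ρ₂ := (ofCoeffs_eq_iff (degree_fixedG_lt hs) _).symm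
  have hsys : (systemMatrix t q).mulVec (fun m => x (.inr m)) =
        systemRhs t q (ρ₁ 0 * ρ₂ 0) (betaCoeff t q ρ₁ ρ₂) (deltaCoeff t q)
          (epsCoeff t q ρ₁ ρ₂) p ↔
      (polyH x).coeff (2 * (n + N - 1)) = ρ₁ 0 * ρ₂ 0 ∧
      (∀ i, (polyH x).eval (t i) = betaCoeff t q ρ₁ ρ₂ i) ∧ (∀ j, (polyH x).eval (q j) = 0) ∧
      (∀ j, (derivative (polyH x)).eval (q j) = p j / mu t q j) ∧
      ∀ j, (derivative (derivative (polyH x))).eval (q j) =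
        deltaCoeff t q j * p j ^ 2 + epsCoeff t q ρ₁ ρ₂ j * p j := by
    rw [funext_iff]
    simp only [Sum.forall, systemMatrix_mulVec_inl _ _ _ hM, systemMatrix_mulVec_t,
      systemMatrix_mulVec_q, systemMatrix_mulVec_q', systemMatrix_mulVec_q'', systemRhs,
      forall_const]
    rfl
  have hinf := hasExponentsAtInfty_iff (t := t) (q := q) (x := x) hM (ρ₁ 0) (ρ₂ 0)
  have ht (i : Fin n) := hasExponentsAt_node_iff (x := x) hs (.inl i) (ρ₁ i.succ) (ρ₂ i.succ)
  have hq (j : Fin N) := isApparentSingularity_node_iff (x := x) hs (.inr j)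
  have hmom (j : Fin N) := tendsto_momentum_node (x := x) hs (.inr j)
  have hne (j : Fin N) := eval_cofactor_ne_zero hs (.inr j)
  simp only [nodes, Sum.elim_inl, Sum.elim_inr] at ht hq hmom hne
  rw [hG, hsys]
  constructor
  · rintro ⟨⟨hI, hT, hQ⟩, hp⟩
    have hGx : polyG x = fixedG t q ρ₁ ρ₂ := by
      rw [polyG_eq_fixedG_iff hs]
      rintro (i | j)
      · exact ((ht i).mp (hT i)).1
      · simpa [residue, nodes] using ((hq j).mp (hQ j)).1
    have hp' (j : Fin N) : (derivative (polyH x)).eval (q j) /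
        (cofactor t q (.inr j)).eval (q j) ^ 2 = p j :=
      tendsto_nhds_unique (hmom j ((hq j).mp (hQ j)).2.1) (hp j)
    have hH' (j : Fin N) : (derivative (polyH x)).eval (q j) =
        p j * (cofactor t q (.inr j)).eval (q j) ^ 2 :=
      (div_eq_iff (pow_ne_zero 2 (hne j))).mp (hp' j)
    refine ⟨hGx, (hinf.mp hI).2, fun i => ((ht i).mp (hT i)).2, fun j => ((hq j).mp (hQ j)).2.1,
      fun j => ?_, fun j => ?_⟩
    · rw [mu_eq, hH', div_div_eq_mul_div, div_one]
    -- With `Φ` the cofactor at `q_j`, the obstruction is `(Φ (G' - Φ') + p Φ²) p + H'' / 2 = 0`;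
    -- the coefficients `deltaCoeff` and `epsCoeff` are read off from it.
    · have h := ((hq j).mp (hQ j)).2.2
      rw [hp', hH', hGx] at h
      rw [deltaCoeff, epsCoeff]
      linear_combination 2 * h
  · rintro ⟨hGx, hI, hT, hQ, hQ', hQ''⟩
    have hval := (polyG_eq_fixedG_iff hs x).mp hGx
    have hH' (j : Fin N) : (derivative (polyH x)).eval (q j) =
        p j * (cofactor t q (.inr j)).eval (q j) ^ 2 := by
      rw [hQ', mu_eq, div_div_eq_mul_div, div_one]
    have hp' (j : Fin N) : (derivative (polyH x)).eval (q j) /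
        (cofactor t q (.inr j)).eval (q j) ^ 2 = p j :=
      (div_eq_iff (pow_ne_zero 2 (hne j))).mpr (hH' j)
    -- Fuchs' relation enters here, to give the exponents at infinity.
    refine ⟨⟨hinf.mpr ⟨by rw [hGx, coeff_fixedG hs hFuchs], hI⟩,
      fun i => (ht i).mpr ⟨hval (.inl i), hT i⟩, fun j => (hq j).mpr ⟨?_, hQ j, ?_⟩⟩, fun j => ?_⟩
    · simpa [residue, nodes] using hval (.inr j)
    · rw [hp', hH', hGx, hQ'', deltaCoeff, epsCoeff]
      ring
    · have h := hmom j (hQ j)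
      rwa [hp'] at h

theorem deltaCoeff_ne_zero (hs : Function.Injective (nodes t q)) (j : Fin N) :
    deltaCoeff t q j ≠ 0 :=
  mul_ne_zero (by norm_num) (pow_ne_zero 2 (eval_cofactor_ne_zero hs (.inr j)))

end LinearSystem

/-! ### Solving the linear system -/

section Interpolation

open Polynomial

theorem nodal_dvd_of_eval_eq_zero {ι : Type*} [Fintype ι] {v : ι → ℂ} (hv : Function.Injective v)
    {P : ℂ[X]} (hP : ∀ i, P.eval (v i) = 0) : Lagrange.nodal Finset.univ v ∣ P := by
  rw [Lagrange.nodal_eq]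
  refine Finset.prod_dvd_of_coprime (fun i _ j _ hij => ?_) fun i _ => ?_
  · exact pairwise_coprime_X_sub_C hv hij
  · exact dvd_iff_isRoot.mpr (hP i)

/-- The linear map evaluating at `q` the polynomial with the given `K` coefficients. -/
def evalMap {N : ℕ} (K : ℕ) (q : Fin N → ℂ) : (Fin K → ℂ) →ₗ[ℂ] (Fin N → ℂ) :=
  LinearMap.pi fun j => leval (q j) ∘ₗ ofCoeffs K

theorem evalMap_apply {N K : ℕ} (q : Fin N → ℂ) (T : Fin K → ℂ) (j : Fin N) :
    evalMap K q T j = (ofCoeffs K T).eval (q j) := rfl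

theorem evalMap_injective {N K : ℕ} {q : Fin N → ℂ} (hq : Function.Injective q) (h : K ≤ N) :
    Function.Injective (evalMap K q) := by
  intro T T' hT
  apply ofCoeffs_injective
  have hd (U : Fin K → ℂ) : (ofCoeffs K U).degree < (Finset.univ : Finset (Fin N)).card := by
    refine (degree_ofCoeffs_lt U).trans_le ?_
    simpa using h
  exact eq_of_degrees_lt_of_eval_index_eq Finset.univ hq.injOn (hd T) (hd T')
    fun j _ => congrFun hT j

theorem evalMap_surjective {N K : ℕ} {q : Fin N → ℂ} (hq : Function.Injective q) (h : N ≤ K) :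
    Function.Surjective (evalMap K q) := by
  intro y
  have hd : (Lagrange.interpolate Finset.univ q y).degree < (K : WithBot ℕ) := by
    refine (Lagrange.degree_interpolate_lt _ hq.injOn).trans_le ?_
    simpa using h
  refine ⟨fun m => (Lagrange.interpolate Finset.univ q y).coeff m, funext fun j => ?_⟩
  rw [evalMap_apply, ofCoeffs_coeff hd]
  exact Lagrange.eval_interpolate_at_node _ hq.injOn (Finset.mem_univ j)

/-- Truncated subtraction covers both cases: evaluation is surjective for `N ≤ K` and injective for
`K ≤ N`. -/
theorem finrank_ker_evalMap {N K : ℕ} {q : Fin N → ℂ} (hq : Function.Injective q) :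
    Module.finrank ℂ (LinearMap.ker (evalMap K q)) = K - N := by
  have h := LinearMap.finrank_range_add_finrank_ker (evalMap K q)
  rw [Module.finrank_fin_fun] at h
  rcases le_total N K with hNK | hKN
  · rw [LinearMap.range_eq_top.mpr (evalMap_surjective hq hNK), finrank_top,
      Module.finrank_fin_fun] at h
    omega
  · rw [LinearMap.ker_eq_bot.mpr (evalMap_injective hq hKN), finrank_bot]
    omega

variable {n N : ℕ} (t : Fin n → ℂ) (q : Fin N → ℂ)

/-- The polynomial `∏ (X - t_i) ∏ (X - q_j)²`. -/
def doubleNodal : ℂ[X] := Lagrange.nodal Finset.univ (nodes t q) * Lagrange.nodal Finset.univ q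

theorem degree_doubleNodal : (doubleNodal t q).degree = (n + 2 * N : ℕ) := by
  rw [doubleNodal, degree_mul, Lagrange.degree_nodal, Lagrange.degree_nodal, Finset.card_univ,
    Finset.card_univ, Fintype.card_sum, Fintype.card_fin, Fintype.card_fin, ← Nat.cast_add]
  congr 1
  omega

theorem doubleNodal_ne_zero : doubleNodal t q ≠ 0 :=
  mul_ne_zero Lagrange.nodal_ne_zero Lagrange.nodal_ne_zero

variable {t q}

theorem degree_doubleNodal_mul_lt (hn : 2 ≤ n) {P : ℂ[X]} :
    (doubleNodal t q * P).degree < (2 * (n + N - 1) : ℕ) ↔ P.degree < (n - 2 : ℕ) := by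
  rw [degree_mul, degree_doubleNodal, show 2 * (n + N - 1) = (n + 2 * N) + (n - 2) by omega,
    Nat.cast_add (n + 2 * N) (n - 2)]
  exact WithBot.add_lt_add_iff_left (WithBot.natCast_ne_bot _)

variable (t q) in
/-- Multiplication by `∏ (X - t_i) ∏ (X - q_j)²` on coefficients. -/
def mulDoubleNodal : (Fin (n - 2) → ℂ) →ₗ[ℂ] (Fin (2 * (n + N) - 1) → ℂ) :=
  LinearMap.pi fun m => lcoeff ℂ m ∘ₗ LinearMap.mulLeft ℂ (doubleNodal t q) ∘ₗ ofCoeffs (n - 2)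

theorem ofCoeffs_mulDoubleNodal (hn : 2 ≤ n) (T : Fin (n - 2) → ℂ) :
    ofCoeffs (2 * (n + N) - 1) (mulDoubleNodal t q T) =
      doubleNodal t q * ofCoeffs (n - 2) T := by
  refine ofCoeffs_coeff (K := 2 * (n + N) - 1) (p := doubleNodal t q * ofCoeffs (n - 2) T) ?_
  refine ((degree_doubleNodal_mul_lt hn).mpr (degree_ofCoeffs_lt T)).trans ?_
  exact_mod_cast (by omega : 2 * (n + N - 1) < 2 * (n + N) - 1)

theorem mulDoubleNodal_injective (hn : 2 ≤ n) : Function.Injective (mulDoubleNodal t q) := by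
  intro T T' h
  apply ofCoeffs_injective
  apply mul_left_cancel₀ (doubleNodal_ne_zero t q)
  rw [← ofCoeffs_mulDoubleNodal hn, ← ofCoeffs_mulDoubleNodal hn, h]

/-- Rows of the system other than those of the second derivatives. -/
abbrev BaseIndex (n N : ℕ) : Type := Unit ⊕ Fin n ⊕ Fin N ⊕ Fin N

/-- The inclusion of the rows other than those of the second derivatives. -/
def baseRow : BaseIndex n N → RowIndex n N := Sum.map id (Sum.map id (Sum.map id Sum.inl))

/-- The row of the second derivative at `q_j`. -/
def secondRow (j : Fin N) : RowIndex n N := .inr (.inr (.inr (.inr j)))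

theorem forall_rowIndex {P : RowIndex n N → Prop} :
    (∀ r, P r) ↔ (∀ b, P (baseRow b)) ∧ ∀ j, P (secondRow j) := by
  simp only [Sum.forall, baseRow, secondRow, Sum.map_inl, Sum.map_inr, id]
  tauto

variable (t q) in
/-- The part of the system not involving second derivatives. -/
def baseMap : (Fin (2 * (n + N) - 1) → ℂ) →ₗ[ℂ] (BaseIndex n N → ℂ) :=
  ((systemMatrix t q).submatrix baseRow id).mulVecLin

variable (t q) in
/-- The part of the system consisting of the second derivatives. -/
def secondMap : (Fin (2 * (n + N) - 1) → ℂ) →ₗ[ℂ] (Fin N → ℂ) :=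
  ((systemMatrix t q).submatrix secondRow id).mulVecLin

theorem baseMap_apply (v : Fin (2 * (n + N) - 1) → ℂ) (b : BaseIndex n N) :
    baseMap t q v b = (systemMatrix t q).mulVec v (baseRow b) := rfl

theorem secondMap_apply (v : Fin (2 * (n + N) - 1) → ℂ) (j : Fin N) :
    secondMap t q v j = (systemMatrix t q).mulVec v (secondRow j) := rfl

/-- Zeros at all nodes, double at the `q_j`, force divisibility by `doubleNodal`; the vanishing top
coefficient leaves a quotient of degree less than `n - 2`. -/
theorem baseMap_eq_zero_iff (hs : Function.Injective (nodes t q)) (hn : 2 ≤ n)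
    (v : Fin (2 * (n + N) - 1) → ℂ) :
    baseMap t q v = 0 ↔ ∃ T, v = mulDoubleNodal t q T := by
  have hq : Function.Injective q := hs.comp Sum.inr_injective
  have hrows : baseMap t q v = 0 ↔
      (ofCoeffs (2 * (n + N) - 1) v).coeff (2 * (n + N - 1)) = 0 ∧
      (∀ a, (ofCoeffs (2 * (n + N) - 1) v).eval (nodes t q a) = 0) ∧
      ∀ j, (derivative (ofCoeffs (2 * (n + N) - 1) v)).eval (q j) = 0 := by
    rw [funext_iff]
    simp only [Sum.forall, baseMap_apply, baseRow, Sum.map_inl, Sum.map_inr, id, nodes,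
      systemMatrix_mulVec_inl _ _ _ (by omega : 0 < n + N), systemMatrix_mulVec_t,
      systemMatrix_mulVec_q, systemMatrix_mulVec_q', Pi.zero_apply, forall_const, Sum.elim_inl,
      Sum.elim_inr]
    tauto
  have hnodal (S : ℂ[X]) (j : Fin N) :
      (derivative (Lagrange.nodal Finset.univ (nodes t q) * S)).eval (q j) =
        (cofactor t q (.inr j)).eval (q j) * S.eval (q j) := by
    have h1 : (derivative (Lagrange.nodal Finset.univ (nodes t q))).eval (q j) =
        (cofactor t q (.inr j)).eval (q j) :=
      Lagrange.eval_nodal_derivative_eval_node_eq (v := nodes t q) (i := Sum.inr j)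
        (Finset.mem_univ _)
    have h2 : (Lagrange.nodal Finset.univ (nodes t q)).eval (q j) = 0 :=
      Lagrange.eval_nodal_at_node (v := nodes t q) (i := Sum.inr j) (Finset.mem_univ _)
    rw [derivative_mul, eval_add, eval_mul, eval_mul, h1, h2, zero_mul, add_zero]
  rw [hrows]
  constructor
  · rintro ⟨htop, hval, hder⟩
    have hdeg : (ofCoeffs (2 * (n + N) - 1) v).degree < (2 * (n + N - 1) : ℕ) := by
      rw [degree_lt_iff_coeff_zero]
      intro m hm
      rcases hm.eq_or_lt with rfl | hlt
      · exact htop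
      · exact coeff_eq_zero_of_degree_lt ((degree_ofCoeffs_lt v).trans_le
          (by exact_mod_cast (by omega : 2 * (n + N) - 1 ≤ m)))
    obtain ⟨S, hS⟩ := nodal_dvd_of_eval_eq_zero hs hval
    obtain ⟨U, hU⟩ := nodal_dvd_of_eval_eq_zero hq (P := S) fun j => by
      have h := hder j
      rw [hS, hnodal] at h
      exact (mul_eq_zero.mp h).resolve_left (eval_cofactor_ne_zero hs (.inr j))
    have hv : ofCoeffs (2 * (n + N) - 1) v = doubleNodal t q * U := by
      rw [hS, hU, doubleNodal, mul_assoc]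
    rw [hv, degree_doubleNodal_mul_lt hn] at hdeg
    refine ⟨fun m => U.coeff m, ofCoeffs_injective ?_⟩
    rw [ofCoeffs_mulDoubleNodal hn, ofCoeffs_coeff hdeg, hv]
  · rintro ⟨T, rfl⟩
    rw [ofCoeffs_mulDoubleNodal hn]
    refine ⟨coeff_eq_zero_of_degree_lt
      ((degree_doubleNodal_mul_lt hn).mpr (degree_ofCoeffs_lt T)), fun a => ?_, fun j => ?_⟩
    · rw [doubleNodal, eval_mul, eval_mul, Lagrange.eval_nodal_at_node (Finset.mem_univ a),
        zero_mul, zero_mul]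
    · rw [doubleNodal, mul_assoc, hnodal, eval_mul,
        Lagrange.eval_nodal_at_node (Finset.mem_univ j), zero_mul, mul_zero]

variable (t q) in
/-- The second derivative of `∏ (X - t_i) ∏ (X - q_j)²` at `q_j`. -/
def secondWeight (j : Fin N) : ℂ :=
  2 * ((cofactor t q (.inr j)).eval (q j) *
    (Lagrange.nodal (Finset.univ.erase j) q).eval (q j))

theorem secondWeight_ne_zero (hs : Function.Injective (nodes t q)) (j : Fin N) :
    secondWeight t q j ≠ 0 := by
  have hq : Function.Injective q := hs.comp Sum.inr_injective
  refine mul_ne_zero two_ne_zero (mul_ne_zero (eval_cofactor_ne_zero hs (.inr j)) ?_)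
  rw [Lagrange.eval_nodal, Finset.prod_ne_zero_iff]
  intro k hk
  exact sub_ne_zero.mpr fun h => (Finset.ne_of_mem_erase hk) (hq h).symm

/-- `doubleNodal` has a double zero at `q_j`, so differentiating the product twice leaves only its
own second derivative times the value of the other factor. -/
theorem secondMap_mulDoubleNodal (hn : 2 ≤ n) (T : Fin (n - 2) → ℂ) (j : Fin N) :
    secondMap t q (mulDoubleNodal t q T) j = secondWeight t q j * evalMap (n - 2) q T j := by
  have h1 : Lagrange.nodal Finset.univ (nodes t q) = (X - C (q j)) * cofactor t q (.inr j) :=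
    Lagrange.nodal_eq_mul_nodal_erase (v := nodes t q) (i := Sum.inr j) (Finset.mem_univ _)
  have h2 : Lagrange.nodal Finset.univ q =
      (X - C (q j)) * Lagrange.nodal (Finset.univ.erase j) q :=
    Lagrange.nodal_eq_mul_nodal_erase (Finset.mem_univ j)
  rw [secondMap_apply, secondRow, systemMatrix_mulVec_q'', ofCoeffs_mulDoubleNodal hn,
    doubleNodal, h1, h2, secondWeight, evalMap_apply]
  simp only [derivative_mul, derivative_add, derivative_sub, derivative_X, derivative_C, eval_add,
    eval_mul, eval_sub, eval_X, eval_C, sub_self, eval_one, derivative_one,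
    eval_zero, sub_zero]
  ring

/-- The kernel has dimension `n - 2`, and `(2n + 2N - 1) - (n - 2) = n + 2N + 1` is the number of
rows. -/
theorem baseMap_surjective (hs : Function.Injective (nodes t q)) (hn : 2 ≤ n) :
    Function.Surjective (baseMap t q) := by
  have hker : LinearMap.ker (baseMap t q) = LinearMap.range (mulDoubleNodal t q) := by
    ext v
    rw [LinearMap.mem_ker, baseMap_eq_zero_iff hs hn, LinearMap.mem_range]
    exact exists_congr fun T => eq_comm
  have h := LinearMap.finrank_range_add_finrank_ker (baseMap t q)
  rw [hker, LinearMap.finrank_range_of_inj (mulDoubleNodal_injective hn), Module.finrank_fin_fun,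
    Module.finrank_fin_fun] at h
  rw [← LinearMap.range_eq_top]
  apply Submodule.eq_top_of_finrank_eq
  rw [Module.finrank_fintype_fun_eq_card]
  simp only [Fintype.card_sum, Fintype.card_fin, Fintype.card_unit]
  omega

/-- In the kernel of `baseMap` the second-derivative rows require that `T` vanish at every `q_j`. -/
theorem finrank_ker_systemMatrix (hs : Function.Injective (nodes t q)) (hn : 2 ≤ n) :
    Module.finrank ℂ (LinearMap.ker (systemMatrix t q).mulVecLin) = n - 2 - N := by
  have hq : Function.Injective q := hs.comp Sum.inr_injective
  have hker : LinearMap.ker (systemMatrix t q).mulVecLin =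
      (LinearMap.ker (evalMap (n - 2) q)).map (mulDoubleNodal t q) := by
    ext v
    have hrow : (systemMatrix t q).mulVec v = 0 ↔ baseMap t q v = 0 ∧ secondMap t q v = 0 := by
      simp only [funext_iff, forall_rowIndex, baseMap_apply, secondMap_apply]
      rfl
    rw [LinearMap.mem_ker, Matrix.mulVecLin_apply, hrow, baseMap_eq_zero_iff hs hn,
      Submodule.mem_map]
    have hsec (T : Fin (n - 2) → ℂ) : secondMap t q (mulDoubleNodal t q T) = 0 ↔
        T ∈ LinearMap.ker (evalMap (n - 2) q) := by
      rw [LinearMap.mem_ker, funext_iff, funext_iff]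
      refine forall_congr' fun j => ?_
      rw [secondMap_mulDoubleNodal hn, Pi.zero_apply, mul_eq_zero,
        or_iff_right (secondWeight_ne_zero hs j)]
    constructor
    · rintro ⟨⟨T, rfl⟩, h⟩
      exact ⟨T, (hsec T).mp h, rfl⟩
    · rintro ⟨T, hT, rfl⟩
      exact ⟨⟨T, rfl⟩, (hsec T).mpr hT⟩
  rw [hker, ← finrank_ker_evalMap (K := n - 2) hq]
  exact (Submodule.equivMapOfInjective _ (mulDoubleNodal_injective hn) _).finrank_eq.symm

/-- Rank-nullity; the two cases of the minimum are those of the truncated difference `n - 2 - N`. -/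
theorem rank_systemMatrix (hs : Function.Injective (nodes t q)) (hn : 2 ≤ n) :
    (systemMatrix t q).rank = min (n + 3 * N + 1) (2 * (n + N) - 1) := by
  have h := LinearMap.finrank_range_add_finrank_ker (systemMatrix t q).mulVecLin
  rw [finrank_ker_systemMatrix hs hn, Module.finrank_fin_fun] at h
  rw [Matrix.rank]
  omega

/-- The linear system is equivalent to the interpolation of `N` values, affine in the momenta up
to squares, by a polynomial of degree less than `n - 2`. -/
theorem exists_parametrization (hs : Function.Injective (nodes t q)) (hn : 2 ≤ n) (r : ℂ)
    (β : Fin n → ℂ) (δ ε : Fin N → ℂ) (hδ : ∀ j, δ j ≠ 0) :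
    ∃ (v₀ : Fin (2 * (n + N) - 1) → ℂ)
      (S : (Fin N → ℂ) →ₗ[ℂ] (Fin (2 * (n + N) - 1) → ℂ)) (κ c : Fin N → ℂ)
      (ℓ : Fin N → (Fin N → ℂ) →ₗ[ℂ] ℂ), (∀ j, κ j ≠ 0) ∧
      (∀ p T, S p + mulDoubleNodal t q T = 0 → p = 0 ∧ T = 0) ∧
      ∀ p v, (systemMatrix t q).mulVec v = systemRhs t q r β δ ε p ↔
        ∃ T, v = v₀ + S p + mulDoubleNodal t q T ∧
          ∀ j, κ j * p j ^ 2 + (c j + ℓ j p) = evalMap (n - 2) q T j := by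
  obtain ⟨R, hR⟩ := (baseMap t q).exists_rightInverse_of_surjective
    (LinearMap.range_eq_top.mpr (baseMap_surjective hs hn))
  have hbR (b : BaseIndex n N → ℂ) : baseMap t q (R b) = b := LinearMap.congr_fun hR b
  let b₀ : BaseIndex n N → ℂ := fun b => systemRhs t q r β δ ε 0 (baseRow b)
  let B : (Fin N → ℂ) →ₗ[ℂ] (BaseIndex n N → ℂ) :=
    { toFun := fun p => Sum.elim 0 (Sum.elim 0 (Sum.elim 0 fun j => p j / mu t q j))
      map_add' := fun p p' => by
        ext (i | i | i | i) <;> simp [add_div]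
      map_smul' := fun a p => by
        ext (i | i | i | i) <;> simp [mul_div_assoc] }
  have hb (p : Fin N → ℂ) (b : BaseIndex n N) :
      systemRhs t q r β δ ε p (baseRow b) = (b₀ + B p) b := by
    rcases b with i | i | i | i <;> simp [b₀, B, baseRow, systemRhs]
  have hd (j : Fin N) := secondWeight_ne_zero hs j
  -- `R (b₀ + B p)` solves the base rows. The row for `H''(q_j)` is then solved for the value of `T`
  -- at `q_j` by dividing by `secondWeight`.
  refine ⟨R b₀, R ∘ₗ B, fun j => δ j / secondWeight t q j,
    fun j => -(secondMap t q (R b₀) j) / secondWeight t q j,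
    fun j => (secondWeight t q j)⁻¹ • (ε j • LinearMap.proj j -
      LinearMap.proj j ∘ₗ secondMap t q ∘ₗ R ∘ₗ B), fun j => div_ne_zero (hδ j) (hd j),
    fun p T h => ?_, fun p v => ?_⟩
  -- `baseMap` kills the multiples of `doubleNodal` and recovers the values `p j / mu t q j`.
  · have h1 := congrArg (baseMap t q) h
    rw [map_add, (baseMap_eq_zero_iff hs hn _).mpr ⟨T, rfl⟩, add_zero, map_zero,
      LinearMap.comp_apply, hbR] at h1
    have hp : p = 0 := by
      ext j
      have h2 : p j / mu t q j = 0 := congrFun h1 (.inr (.inr (.inr j)))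
      rw [mu_eq, div_div_eq_mul_div, div_one, mul_eq_zero] at h2
      exact h2.resolve_right (pow_ne_zero 2 (eval_cofactor_ne_zero hs (.inr j)))
    refine ⟨hp, mulDoubleNodal_injective (t := t) (q := q) hn ?_⟩
    rwa [hp, map_zero, zero_add, ← map_zero (mulDoubleNodal t q)] at h
  · have hbase : (∀ b, (systemMatrix t q).mulVec v (baseRow b) =
        systemRhs t q r β δ ε p (baseRow b)) ↔
        ∃ T, v = R b₀ + (R ∘ₗ B) p + mulDoubleNodal t q T := by
      have h1 : (∀ b, (systemMatrix t q).mulVec v (baseRow b) =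
          systemRhs t q r β δ ε p (baseRow b)) ↔ baseMap t q (v - R (b₀ + B p)) = 0 := by
        rw [map_sub, hbR, sub_eq_zero, funext_iff]
        exact forall_congr' fun b => by rw [hb, baseMap_apply]
      rw [h1, baseMap_eq_zero_iff hs hn]
      refine exists_congr fun T => ?_
      rw [sub_eq_iff_eq_add', map_add]
      rfl
    rw [funext_iff, forall_rowIndex, hbase, ← exists_and_right]
    refine exists_congr fun T => and_congr_right fun hv => forall_congr' fun j => ?_
    rw [← secondMap_apply, hv, map_add, map_add, Pi.add_apply, Pi.add_apply,
      secondMap_mulDoubleNodal hn, secondRow, systemRhs]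
    simp only [LinearMap.smul_apply, LinearMap.sub_apply, LinearMap.comp_apply,
      LinearMap.proj_apply, smul_eq_mul]
    have hdj := hd j
    constructor
    · intro h
      field_simp
      linear_combination -h
    · intro h
      field_simp at h
      linear_combination -h

end Interpolation

/-! ### The set of equations and the set of momenta -/

section Geometry

open MvPolynomial

/-- Polynomials over `ℂ` are determined by their values, so one may solve for the square pointwise,
dividing by `a k`. -/
theorem hasSeparatedSquares_of_eval {ι κ σ : Type} [Fintype κ] {e : ι ⊕ κ ≃ σ}
    {F : κ → MvPolynomial σ ℂ} {a : κ → ℂ} (ha : ∀ k, a k ≠ 0) (r : κ → MvPolynomial ι ℂ)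
    (ℓ : κ → (κ → ℂ) →ₗ[ℂ] ℂ)
    (h : ∀ k v, eval v (F k) = a k * v (e (.inr k)) ^ 2 + eval (fun i => v (e (.inl i))) (r k) +
      ℓ k fun l => v (e (.inr l))) :
    HasSeparatedSquares e F := by
  classical
  intro k
  refine ⟨(a k)⁻¹, C (-(a k)⁻¹) * r k,
    Finsupp.equivFunOnFinite.symm fun l => C (-(a k)⁻¹ * ℓ k (Pi.single l 1)), ?_⟩
  apply MvPolynomial.funext
  intro v
  have hℓ : (ℓ k fun l => v (e (.inr l))) = ∑ l, ℓ k (Pi.single l 1) * v (e (.inr l)) := by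
    have := eval_affinePoly 0 (ℓ k) fun l => v (e (.inr l))
    simpa [affinePoly] using this.symm
  rw [Finsupp.sum_fintype _ _ (by simp)]
  simp only [map_add, map_mul, map_pow, map_sum, eval_X, eval_C, h, hℓ, eval_rename, rename_C,
    Finsupp.equivFunOnFinite_symm_apply_apply, mul_assoc, ← Finset.mul_sum]
  have hak := ha k
  have hcomp : v ∘ e ∘ Sum.inl = fun i => v (e (.inl i)) := rfl
  rw [hcomp]
  field_simp
  ring

theorem coeff_affinePoly_of_degree_two {σ : Type} [Fintype σ] [DecidableEq σ] (c : ℂ)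
    (ℓ : (σ → ℂ) →ₗ[ℂ] ℂ) (j : σ) : coeff (Finsupp.single j 2) (affinePoly c ℓ) = 0 := by
  have h1 : coeff (Finsupp.single j 2) (C c : MvPolynomial σ ℂ) = 0 := by
    rw [coeff_C, if_neg]
    intro h
    have := DFunLike.congr_fun h j
    simp at this
  have h2 (i : σ) : coeff (Finsupp.single j 2) (C (ℓ (Pi.single i 1)) * X i) = 0 := by
    rw [coeff_C_mul, coeff_X, if_neg, mul_zero]
    intro h
    have := congrArg Finsupp.degree h
    simp at this
  rw [affinePoly, coeff_add, h1, coeff_sum]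
  simp [h2]

theorem totalDegree_affinePoly_le {σ : Type} [Fintype σ] [DecidableEq σ] (c : ℂ)
    (ℓ : (σ → ℂ) →ₗ[ℂ] ℂ) : (affinePoly c ℓ).totalDegree ≤ 1 := by
  refine (totalDegree_add _ _).trans (max_le (by simp) ?_)
  refine totalDegree_finsetSum_le fun i _ => ?_
  refine (totalDegree_mul _ _).trans ?_
  simp

/-- The polynomial `a p_j² + c + ℓ p` in the momenta. -/
def momentumPoly {N : ℕ} (a c : Fin N → ℂ) (ℓ : Fin N → (Fin N → ℂ) →ₗ[ℂ] ℂ) (j : Fin N) :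
    MvPolynomial (Fin N) ℂ :=
  C (a j) * X j ^ 2 + affinePoly (c j) (ℓ j)

section MomentumPoly

variable {N : ℕ} (a c : Fin N → ℂ) (ℓ : Fin N → (Fin N → ℂ) →ₗ[ℂ] ℂ)

theorem eval_momentumPoly (j : Fin N) (p : Fin N → ℂ) :
    eval p (momentumPoly a c ℓ j) = a j * p j ^ 2 + (c j + ℓ j p) := by
  simp [momentumPoly]

theorem coeff_momentumPoly (i j : Fin N) :
    coeff (Finsupp.single j 2) (momentumPoly a c ℓ i) = if i = j then a i else 0 := by
  rw [momentumPoly, coeff_add, coeff_affinePoly_of_degree_two, add_zero, coeff_C_mul, coeff_X_pow]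
  simp [Finsupp.single_left_inj]

theorem totalDegree_momentumPoly_le (j : Fin N) : (momentumPoly a c ℓ j).totalDegree ≤ 2 := by
  refine (totalDegree_add _ _).trans (max_le ?_
    ((totalDegree_affinePoly_le _ _).trans one_le_two))
  refine (totalDegree_mul _ _).trans ?_
  simp

variable {m : ℕ} (hm : m ≤ N) (q : Fin N → ℂ)

/-- The decomposition of the momenta into the first `m` and the others. -/
def splitMomenta : Fin m ⊕ Fin (N - m) ≃ Fin N :=
  finSumFinEquiv.trans (finCongr (Nat.add_sub_cancel' hm))

theorem splitMomenta_inl_val (i : Fin m) : (splitMomenta hm (.inl i) : ℕ) = i := by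
  simp [splitMomenta]

theorem splitMomenta_inr_val (k : Fin (N - m)) : (splitMomenta hm (.inr k) : ℕ) = m + k := by
  simp [splitMomenta]

/-- The first `m` nodes. -/
def firstNodes (i : Fin m) : ℂ := q (splitMomenta hm (.inl i))

/-- The obstruction to interpolating all the values of `momentumPoly` by the polynomial of degree
less than `m` that interpolates the first `m` of them. -/
def obstruction (k : Fin (N - m)) : MvPolynomial (Fin N) ℂ :=
  momentumPoly a c ℓ (splitMomenta hm (.inr k)) -
    ∑ i, C ((Lagrange.basis Finset.univ (firstNodes hm q) i).eval
      (q (splitMomenta hm (.inr k)))) * momentumPoly a c ℓ (splitMomenta hm (.inl i))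

/-- The subtracted interpolation terms contain squares of the first `m` momenta only, so they do not
affect the monomials considered. -/
theorem coeff_obstruction_ne_zero_iff (ha : ∀ j, a j ≠ 0) (k : Fin (N - m)) (j : Fin N)
    (hj : m ≤ j) :
    coeff (Finsupp.single j 2) (obstruction a c ℓ hm q k) ≠ 0 ↔ (j : ℕ) = m + k := by
  have hne (i : Fin m) : splitMomenta hm (.inl i) ≠ j := by
    intro h
    have := splitMomenta_inl_val hm i
    rw [h] at this
    omega
  rw [obstruction, coeff_sub, coeff_sum, coeff_momentumPoly]
  simp only [coeff_C_mul, coeff_momentumPoly, hne, if_false, mul_zero, Finset.sum_const_zero,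
    sub_zero]
  rw [← splitMomenta_inr_val hm k, ← Fin.ext_iff]
  split_ifs with h
  · simp [h, ha]
  · simp [Ne.symm h]

theorem totalDegree_obstruction (ha : ∀ j, a j ≠ 0) (k : Fin (N - m)) :
    (obstruction a c ℓ hm q k).totalDegree = 2 := by
  apply le_antisymm
  · refine (totalDegree_sub _ _).trans (max_le (totalDegree_momentumPoly_le _ _ _ _) ?_)
    refine totalDegree_finsetSum_le fun i _ => ?_
    refine (totalDegree_mul _ _).trans ?_
    simpa using totalDegree_momentumPoly_le _ _ _ _
  · have hk := splitMomenta_inr_val hm k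
    have h := (coeff_obstruction_ne_zero_iff a c ℓ hm q ha k (splitMomenta hm (.inr k))
      (by omega)).mpr hk
    simpa using le_totalDegree (mem_support_iff.mpr h)

theorem eval_obstruction (k : Fin (N - m)) (p : Fin N → ℂ) :
    eval p (obstruction a c ℓ hm q k) = eval p (momentumPoly a c ℓ (splitMomenta hm (.inr k))) -
      (Lagrange.interpolate Finset.univ (firstNodes hm q) fun i =>
        eval p (momentumPoly a c ℓ (splitMomenta hm (.inl i)))).eval
          (q (splitMomenta hm (.inr k))) := by
  rw [obstruction, map_sub, map_sum, Lagrange.interpolate_apply, Polynomial.eval_finsetSum]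
  congr 1
  refine Finset.sum_congr rfl fun i _ => ?_
  rw [map_mul, eval_C, Polynomial.eval_mul, Polynomial.eval_C, mul_comm]

/-- The values at the first `m` nodes determine `T`; the obstructions compare its values at the
other nodes with the prescribed ones. -/
theorem exists_interpolation_iff (hq : Function.Injective q) (p : Fin N → ℂ) :
    (∃ T : Fin m → ℂ, ∀ j, eval p (momentumPoly a c ℓ j) = evalMap m q T j) ↔
      ∀ k, eval p (obstruction a c ℓ hm q k) = 0 := by
  have hfirst : Function.Injective (firstNodes hm q) :=
    hq.comp ((splitMomenta hm).injective.comp Sum.inl_injective)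
  have hcard : ((Finset.univ : Finset (Fin m)).card : WithBot ℕ) = m := by simp
  simp only [eval_obstruction, sub_eq_zero]
  constructor
  · rintro ⟨T, hT⟩ k
    rw [hT, evalMap_apply]
    congr 1
    refine Lagrange.eq_interpolate_of_eval_eq _ hfirst.injOn ?_ fun i _ => (hT _).symm
    rw [hcard]
    exact degree_ofCoeffs_lt T
  · intro h
    set P := Lagrange.interpolate Finset.univ (firstNodes hm q) fun i =>
        eval p (momentumPoly a c ℓ (splitMomenta hm (.inl i))) with hP
    have hd : P.degree < (m : WithBot ℕ) := by
      rw [← hcard]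
      exact Lagrange.degree_interpolate_lt _ hfirst.injOn
    refine ⟨fun i => P.coeff i, fun j => ?_⟩
    rw [evalMap_apply, ofCoeffs_coeff hd]
    obtain ⟨s, rfl⟩ := (splitMomenta hm).surjective j
    rcases s with i | k
    · exact (Lagrange.eval_interpolate_at_node (v := firstNodes hm q)
        (fun i => eval p (momentumPoly a c ℓ (splitMomenta hm (.inl i)))) hfirst.injOn
        (Finset.mem_univ i)).symm
    · exact h k

/-- The first `m` momenta play the role of `x`: their squares go into the part depending on `x`
alone, and each linear form splits into its restrictions to `x` and `y`. -/
theorem hasSeparatedSquares_obstruction (ha : ∀ j, a j ≠ 0) :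
    HasSeparatedSquares (splitMomenta hm) (obstruction a c ℓ hm q) := by
  let e := splitMomenta hm
  let L (k : Fin (N - m)) (i : Fin m) : ℂ :=
    (Lagrange.basis Finset.univ (firstNodes hm q) i).eval (q (e (.inr k)))
  let lin (k : Fin (N - m)) : (Fin N → ℂ) →ₗ[ℂ] ℂ := ℓ (e (.inr k)) - ∑ i, L k i • ℓ (e (.inl i))
  let ix : (Fin m → ℂ) →ₗ[ℂ] (Fin N → ℂ) :=
    LinearMap.pi fun j => Sum.elim (fun i => LinearMap.proj i) (fun _ => 0) (e.symm j)
  let iy : (Fin (N - m) → ℂ) →ₗ[ℂ] (Fin N → ℂ) :=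
    LinearMap.pi fun j => Sum.elim (fun _ => 0) (fun i => LinearMap.proj i) (e.symm j)
  have hsplit (v : Fin N → ℂ) : v = ix (fun i => v (e (.inl i))) + iy fun l => v (e (.inr l)) := by
    ext j
    obtain ⟨s, rfl⟩ := e.surjective j
    rcases s with i | k <;> simp [ix, iy]
  refine hasSeparatedSquares_of_eval (a := fun k => a (e (.inr k))) (fun k => ha _)
    (fun k => affinePoly (c (e (.inr k)) - ∑ i, L k i * c (e (.inl i))) (lin k ∘ₗ ix) -
      ∑ i, C (L k i * a (e (.inl i))) * X i ^ 2) (fun k => lin k ∘ₗ iy) fun k v => ?_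
  have hlin : lin k (ix fun i => v (e (.inl i))) + lin k (iy fun l => v (e (.inr l))) =
      ℓ (e (.inr k)) v - ∑ i, L k i * ℓ (e (.inl i)) v := by
    rw [← map_add, ← hsplit]
    simp [lin]
  rw [obstruction, map_sub, map_sum, map_sub, eval_affinePoly, map_sum, eval_momentumPoly]
  simp only [map_mul, eval_C, eval_momentumPoly, map_pow, eval_X, LinearMap.comp_apply]
  have hsum : ∑ i, L k i * (a (e (.inl i)) * v (e (.inl i)) ^ 2 +
      (c (e (.inl i)) + ℓ (e (.inl i)) v)) = ∑ i, L k i * a (e (.inl i)) * v (e (.inl i)) ^ 2 +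
        ∑ i, L k i * c (e (.inl i)) + ∑ i, L k i * ℓ (e (.inl i)) v := by
    rw [← Finset.sum_add_distrib, ← Finset.sum_add_distrib]
    exact Finset.sum_congr rfl fun i _ => by ring
  change _ - ∑ i, L k i * (a (e (.inl i)) * v (e (.inl i)) ^ 2 +
      (c (e (.inl i)) + ℓ (e (.inl i)) v)) = _
  rw [hsum]
  linear_combination -hlin

/-- The equations in the unknowns `(T, p)` expressing that the polynomial with coefficients `T`
takes the values of `momentumPoly` at `p`. -/
def valueEquation (m : ℕ) (q : Fin N → ℂ) (j : Fin N) : MvPolynomial (Fin m ⊕ Fin N) ℂ :=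
  rename .inr (momentumPoly a c ℓ j) - affinePoly 0
    (LinearMap.proj j ∘ₗ evalMap m q ∘ₗ LinearMap.funLeft ℂ ℂ Sum.inl)

theorem eval_valueEquation (j : Fin N) (v : Fin m ⊕ Fin N → ℂ) :
    eval v (valueEquation a c ℓ m q j) =
      eval (fun l => v (.inr l)) (momentumPoly a c ℓ j) - evalMap m q (fun i => v (.inl i)) j := by
  rw [valueEquation, map_sub, eval_rename, eval_affinePoly, zero_add]
  rfl

/-- Here `x = T`, which enters linearly, and `y = p`. -/
theorem hasSeparatedSquares_valueEquation (ha : ∀ j, a j ≠ 0) :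
    HasSeparatedSquares (Equiv.refl _) (valueEquation a c ℓ m q) := by
  refine hasSeparatedSquares_of_eval ha
    (fun j => affinePoly (c j) (-(LinearMap.proj j ∘ₗ evalMap m q))) ℓ fun j v => ?_
  rw [eval_valueEquation, eval_momentumPoly, eval_affinePoly]
  simp only [LinearMap.neg_apply, LinearMap.comp_apply, LinearMap.proj_apply, Equiv.refl_apply]
  ring

end MomentumPoly

end Geometry

/-! ### ### Dimension of the parametrized set and affine solution spaces -/

section Conclusions

open MvPolynomial

/-- A set of vectors `(g, v)` with fixed `g`, and with `v` parametrized in an affine and injective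
way by those `(T, p)` for which the polynomial with coefficients `T` takes values at `q` that
depend on `p` as `momentumPoly` does, is algebraic, and its dimension is the number of
coordinates of `T`. -/
theorem isAlgebraicSet_and_algDim_of_parametrization {N M m K : ℕ} {q : Fin N → ℂ}
    {V : Set (Fin M ⊕ Fin K → ℂ)} {g : Fin M → ℂ} {v₀ : Fin K → ℂ}
    {S : (Fin N → ℂ) →ₗ[ℂ] (Fin K → ℂ)} {W : (Fin m → ℂ) →ₗ[ℂ] (Fin K → ℂ)} {a c : Fin N → ℂ}
    {ℓ : Fin N → (Fin N → ℂ) →ₗ[ℂ] ℂ}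
    (ha : ∀ j, a j ≠ 0) (hinj : ∀ p T, S p + W T = 0 → p = 0 ∧ T = 0)
    (hV : ∀ x, x ∈ V ↔ ∃ p, (∀ i, x (.inl i) = g i) ∧
      ∃ T, (fun i => x (.inr i)) = v₀ + S p + W T ∧
        ∀ j, a j * p j ^ 2 + (c j + ℓ j p) = evalMap m q T j) :
    IsAlgebraicSet V ∧ algDim V = (m : WithBot ℕ∞) := by
  let Λ : (Fin m ⊕ Fin N → ℂ) →ₗ[ℂ] (Fin M ⊕ Fin K → ℂ) :=
    LinearMap.pi (Sum.elim (fun _ => 0) fun i => LinearMap.proj i ∘ₗ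
      (S ∘ₗ LinearMap.funLeft ℂ ℂ Sum.inr + W ∘ₗ LinearMap.funLeft ℂ ℂ Sum.inl))
  have hΛl (v) (i : Fin M) : Λ v (.inl i) = 0 := rfl
  have hΛr (v) (i : Fin K) : Λ v (.inr i) =
      (S (fun l => v (.inr l)) + W fun l => v (.inl l)) i := rfl
  have hΛ : Function.Injective Λ := by
    rw [injective_iff_map_eq_zero]
    intro v hv
    obtain ⟨hp, hT⟩ := hinj (fun l => v (.inr l)) (fun l => v (.inl l)) <| by
      ext i
      rw [← hΛr, hv]
      rfl
    ext (i | j)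
    · exact congrFun hT i
    · exact congrFun hp j
  obtain ⟨A, B, hA, hBA⟩ := exists_polyMap_of_injective (Sum.elim g v₀) Λ hΛ
  -- The set is an affine embedding of the zeros of `N` equations in the `m + N` unknowns `(T, p)`.
  have himage : V = polyMap A '' {v | ∀ j, eval v (valueEquation a c ℓ m q j) = 0} := by
    ext x
    rw [hV, hA]
    simp only [Set.mem_image, Set.mem_ofPred_eq, eval_valueEquation, eval_momentumPoly,
      sub_eq_zero]
    constructor
    · rintro ⟨p, hg, T, hT, hE⟩
      refine ⟨Sum.elim T p, hE, ?_⟩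
      ext (i | i)
      · rw [Pi.add_apply, hΛl, Sum.elim_inl, add_zero, hg]
      · rw [Pi.add_apply, hΛr, Sum.elim_inr]
        have := congrFun hT i
        simp only [Pi.add_apply, add_assoc] at this ⊢
        exact this.symm
    · rintro ⟨v, hv, rfl⟩
      refine ⟨fun l => v (.inr l), fun i => ?_, fun l => v (.inl l), ?_, hv⟩
      · rw [Pi.add_apply, hΛl, Sum.elim_inl, add_zero]
      · ext i
        rw [Pi.add_apply, hΛr, Sum.elim_inr, Pi.add_apply, Pi.add_apply, Pi.add_apply, add_assoc]
  rw [himage]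
  refine ⟨isAlgebraicSet_image_polyMap _ A B hBA, ?_⟩
  rw [algDim_image_polyMap _ A B hBA, (hasSeparatedSquares_valueEquation a c ℓ q ha).algDim_zeros]
  simp

/-- The solutions of an inhomogeneous linear system, with some coordinates prescribed, form an
affine space directed by the kernel. -/
theorem exists_affineSubspace_of_linear {ι κ ρ : Type*} [Fintype ι] [Fintype κ] [Finite ρ]
    (M : Matrix ρ κ ℂ) (b : ρ → ℂ) (g : ι → ℂ) {v : κ → ℂ} (hv : M.mulVec v = b) :
    ∃ A : AffineSubspace ℂ (ι ⊕ κ → ℂ),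
      (A : Set (ι ⊕ κ → ℂ)) =
        {x | (∀ i, x (.inl i) = g i) ∧ M.mulVec (fun i => x (.inr i)) = b} ∧
      (A : Set (ι ⊕ κ → ℂ)).Nonempty ∧
      Module.finrank ℂ A.direction = Module.finrank ℂ (LinearMap.ker M.mulVecLin) := by
  let Λ : (κ → ℂ) →ₗ[ℂ] (ι ⊕ κ → ℂ) :=
    LinearMap.pi (Sum.elim (fun _ => 0) fun i => LinearMap.proj i)
  have hΛ : Function.Injective Λ := fun u w h => funext fun i => congrFun h (.inr i)
  refine ⟨AffineSubspace.mk' (Sum.elim g v) ((LinearMap.ker M.mulVecLin).map Λ), ?_,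
    AffineSubspace.mk'_nonempty _ _, ?_⟩
  · ext x
    rw [SetLike.mem_coe, AffineSubspace.mem_mk', Submodule.mem_map, vsub_eq_sub]
    constructor
    · rintro ⟨u, hu, hux⟩
      have hx : x = Λ u + Sum.elim g v := eq_add_of_sub_eq hux.symm
      refine ⟨fun i => ?_, ?_⟩
      · rw [hx]
        simp [Λ]
      · have : (fun i => x (.inr i)) = u + v := by
          ext i
          rw [hx]
          simp [Λ]
        have hu' : M.mulVec u = 0 := hu
        rw [this, Matrix.mulVec_add, hv, hu', zero_add]
    · rintro ⟨hg, hb⟩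
      refine ⟨(fun i => x (.inr i)) - v, ?_, ?_⟩
      · rw [LinearMap.mem_ker, Matrix.mulVecLin_apply, Matrix.mulVec_sub, hb, hv, sub_self]
      · ext (i | i)
        · simp [Λ, hg]
        · simp [Λ]
  · rw [AffineSubspace.direction_mk']
    exact (Submodule.equivMapOfInjective Λ hΛ _).finrank_eq.symm

end Conclusions

end

end Fuchs

/-! ### ### The main theorem -/

theorem corollary2 (n N : ℕ) (hn : 2 ≤ n)
    (t : Fin n → ℂ) (q : Fin N → ℂ)
    (ht : Function.Injective t) (hq : Function.Injective q) (htq : ∀ i j, t i ≠ q j)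
    (ρ₁ ρ₂ : Fin (n + 1) → ℂ)
    (hFuchs : ∑ i, (ρ₁ i + ρ₂ i) = (n : ℂ) - 1 - (N : ℂ)) :
    -- the space of equations is an algebraic set of dimension `n - 2`
    (Fuchs.IsAlgebraicSet (Fuchs.equationSpace t q ρ₁ ρ₂) ∧
      Fuchs.algDim (Fuchs.equationSpace t q ρ₁ ρ₂) = ((n - 2 : ℕ) : WithBot ℕ∞)) ∧
    -- every equation of the space has momenta; for given momenta `p` the coefficients of `G` are
    -- uniquely determined and those of `H` are governed by a linear system of maximal rank
    (∀ x ∈ Fuchs.equationSpace t q ρ₁ ρ₂, ∃ p, Fuchs.HasMomenta t q x p) ∧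
    (∃ (g : Fin (n + N) → ℂ) (β : Fin n → ℂ) (δ ε : Fin N → ℂ), (∀ j, δ j ≠ 0) ∧
      ∀ (p : Fin N → ℂ) (x : Fuchs.CoeffSpace n N),
        x ∈ Fuchs.equationsWithMomenta t q ρ₁ ρ₂ p ↔
          (∀ m, x (Sum.inl m) = g m) ∧
          (Fuchs.systemMatrix t q).mulVec (fun m => x (Sum.inr m)) =
            Fuchs.systemRhs t q (ρ₁ 0 * ρ₂ 0) β δ ε p) ∧
    (Fuchs.systemMatrix t q).rank = min (n + 3 * N + 1) (2 * (n + N) - 1) ∧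
    -- `N ≤ n - 2`: for all momenta the solutions form an affine space of dimension `n - 2 - N`,
    -- so that the system is underdetermined when `N < n - 2`
    (N ≤ n - 2 → ∀ p : Fin N → ℂ,
      ∃ A : AffineSubspace ℂ (Fuchs.CoeffSpace n N),
        (A : Set (Fuchs.CoeffSpace n N)) = Fuchs.equationsWithMomenta t q ρ₁ ρ₂ p ∧
        (A : Set (Fuchs.CoeffSpace n N)).Nonempty ∧
        Module.finrank ℂ A.direction = n - 2 - N) ∧
    -- `N > n - 2`: an equation with momenta `p` exists, and is then unique, exactly when `p`
    -- satisfies `N - n + 2` independent quadratic equations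
    (n - 2 < N →
      ∃ F : Fin (N - (n - 2)) → MvPolynomial (Fin N) ℂ,
        (∀ k, (F k).totalDegree = 2) ∧
        -- `F k` contains the square of the `(n - 2 + k)`-th momentum, the other equations do not
        (∀ (k : Fin (N - (n - 2))) (j : Fin N), n - 2 ≤ (j : ℕ) →
          ((F k).coeff (Finsupp.single j 2) ≠ 0 ↔ (j : ℕ) = n - 2 + k)) ∧
        AlgebraicIndependent ℂ F ∧
        -- the common zero set has codimension `N - n + 2`
        Fuchs.algDim {p : Fin N → ℂ | ∀ k, MvPolynomial.eval p (F k) = 0} =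
          ((n - 2 : ℕ) : WithBot ℕ∞) ∧
        ∀ p : Fin N → ℂ,
          ((Fuchs.equationsWithMomenta t q ρ₁ ρ₂ p).Nonempty ↔
            ∀ k, MvPolynomial.eval p (F k) = 0) ∧
          (Fuchs.equationsWithMomenta t q ρ₁ ρ₂ p).Subsingleton) := by
  have hM : 0 < n + N := by omega
  have hs : Function.Injective (Fuchs.nodes t q) := Fuchs.nodes_injective ht hq htq
  have hmem := Fuchs.mem_equationsWithMomenta_iff (ρ₁ := ρ₁) (ρ₂ := ρ₂) hs hM hFuchs
  obtain ⟨v₀, S, κ, c, ℓ, hκ, hinj, hpar⟩ := Fuchs.exists_parametrization hs hn (ρ₁ 0 * ρ₂ 0)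
    (Fuchs.betaCoeff t q ρ₁ ρ₂) (Fuchs.deltaCoeff t q) (Fuchs.epsCoeff t q ρ₁ ρ₂)
    (Fuchs.deltaCoeff_ne_zero hs)
  refine ⟨?_, fun x hx => Fuchs.exists_hasMomenta hs hx,
    ⟨_, _, _, _, Fuchs.deltaCoeff_ne_zero hs, hmem⟩, Fuchs.rank_systemMatrix hs hn, ?_, ?_⟩
  · refine Fuchs.isAlgebraicSet_and_algDim_of_parametrization (q := q) (v₀ := v₀) (c := c)
      (ℓ := ℓ) (g := fun m => (Fuchs.fixedG t q ρ₁ ρ₂).coeff m) hκ hinj fun x => ?_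
    simp only [← hpar]
    constructor
    · intro hx
      obtain ⟨p, hp⟩ := Fuchs.exists_hasMomenta hs hx
      exact ⟨p, (hmem p x).mp ⟨hx, hp⟩⟩
    · rintro ⟨p, hp⟩
      exact ((hmem p x).mpr hp).1
  · intro hN p
    -- At `N ≤ n - 2` nodes arbitrary values can be interpolated, so no momenta are excluded.
    obtain ⟨T, hT⟩ := Fuchs.evalMap_surjective hq hN fun j => κ j * p j ^ 2 + (c j + ℓ j p)
    obtain ⟨A, hA, hne, hdim⟩ := Fuchs.exists_affineSubspace_of_linear (Fuchs.systemMatrix t q) _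
      (fun m : Fin (n + N) => (Fuchs.fixedG t q ρ₁ ρ₂).coeff m)
      ((hpar p _).mpr ⟨T, rfl, fun j => (congrFun hT j).symm⟩)
    refine ⟨A, ?_, hne, hdim.trans (Fuchs.finrank_ker_systemMatrix hs hn)⟩
    rw [hA]
    exact Set.ext fun x => (hmem p x).symm
  · intro hN
    have hF := Fuchs.hasSeparatedSquares_obstruction κ c ℓ hN.le q hκ
    refine ⟨Fuchs.obstruction κ c ℓ hN.le q, Fuchs.totalDegree_obstruction κ c ℓ hN.le q hκ,
      Fuchs.coeff_obstruction_ne_zero_iff κ c ℓ hN.le q hκ, hF.algebraicIndependent, ?_,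
      fun p => ⟨?_, ?_⟩⟩
    · rw [hF.algDim_zeros, Nat.card_fin]
    · rw [← Fuchs.exists_interpolation_iff κ c ℓ hN.le q hq p]
      simp only [Fuchs.eval_momentumPoly]
      constructor
      · rintro ⟨x, hx⟩
        obtain ⟨T, -, hT⟩ := (hpar p _).mp ((hmem p x).mp hx).2
        exact ⟨T, hT⟩
      · rintro ⟨T, hT⟩
        exact ⟨Sum.elim (fun m => (Fuchs.fixedG t q ρ₁ ρ₂).coeff m) _,
          (hmem p _).mpr ⟨fun m => rfl, (hpar p _).mpr ⟨T, rfl, hT⟩⟩⟩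
    -- With more than `n - 2` nodes, `T` is determined by its values, which depend on `p` alone.
    · intro x hx y hy
      obtain ⟨hxG, hxH⟩ := (hmem p x).mp hx
      obtain ⟨hyG, hyH⟩ := (hmem p y).mp hy
      obtain ⟨T, hxT, hT⟩ := (hpar p _).mp hxH
      obtain ⟨T', hyT, hT'⟩ := (hpar p _).mp hyH
      have hTT : T = T' := Fuchs.evalMap_injective hq hN.le
        (funext fun j => (hT j).symm.trans (hT' j))
      ext (m | m)
      · rw [hxG, hyG]
      · exact congrFun (hxT.trans (hTT ▸ hyT.symm)) m
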